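/- Work at a point of an oriented space-time with metric $g$ of signature $(-,+,+,+)$ and volume element $\eta=e_0\wedge e_1\wedge e_2\wedge e_3$ ($\{e_\alpha\}$ a positively oriented orthonormal frame); indices are raised with $g$. For a 2-form $F$ and a double 2-form $W$ put $(*F)_{\alpha\beta}=\frac12\eta_{\alpha\beta}{}^{\mu\nu}F_{\mu\nu}$, $(*W)_{\alpha\beta\rho\sigma}=\frac12\eta_{\alpha\beta}{}^{\mu\nu}W_{\mu\nu\rho\sigma}$; the self-dual part of $W$ is $\mathcal W=\frac12(W-\mathrm i*W)$. A Weyl tensor is a real trace-free 4-tensor with the symmetries of the Riemann tensor; its Bel–Robinson (BR) tensor is $$T_{\alpha\mu\beta\nu}=\tfrac14\left(W_\alpha{}^\rho{}_\beta{}^\sigma W_{\mu\rho\nu\sigma}+*W_\alpha{}^\rho{}_\beta{}^\sigma *W_{\mu\rho\nu\sigma}\right).$$ Powers and traces of $T$ are $(T\bullet R)_{\alpha\beta\rho\sigma}=T_{\alpha\beta}{}^{\mu\nu}R_{\mu\nu\rho\sigma}$ and $\mathrm{Tr}\,T=T^{\alpha\beta}{}_{\alpha\beta}$. Let $T$ be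 a BR tensor with $\mathrm{Tr}\,T^2=0$ and $9t^3\equiv\mathrm{Tr}\,T^3\neq0$, $t\in\mathbb R$ (type IM$^{[-6]}$). Put $A=\frac13\left(\frac1tT+\frac1{t^2}T^2+\frac1{t^3}T^3\right)$, $$B_{\alpha\beta\gamma\delta\lambda\mu}=2A_{\alpha\beta\lambda}{}^{\epsilon}A_{\gamma\delta\mu\epsilon}-\tfrac12A_{\alpha\beta\gamma\delta}\,g_{\lambda\mu},\qquad C_{\alpha\beta\gamma\delta\lambda\mu\nu\rho}=2A_{\alpha\beta\nu}{}^{\epsilon}B_{\gamma\delta\lambda\mu\rho\epsilon}-\tfrac12B_{\alpha\beta\gamma\delta\lambda\mu}\,g_{\nu\rho}.$$ For a real symmetric tensor $X$ let $A(X)$, $B(X)$, $B(X,X)$ be obtained by contracting the last pairs of indices with $X$, let $C(X,X)_{\alpha\beta\nu\rho}=C_{\alpha\beta\gamma\delta\lambda\mu\nu\rho}X^{\gamma\delta}X^{\lambda\mu}$, and let $A(X,X)$, $B(X,X,X)$, $C(X,X,X,X)$ be the full contractions. Put $$\alpha=\tfrac13A(X,X),\quad\beta=\tfrac16B(X,X,X),\quad\gamma=\tfrac1{12}C(X,X,X,X),\quad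 r=\gamma-\alpha^2,\quad s=\tfrac12(3\alpha\gamma-\beta^2)-\alpha^3,$$ $$E=A(X)\otimes A(X)-\tfrac12C(X,X),\qquad I=\tfrac14B(X,X)\otimes B(X,X)-\beta B(X).$$ For a complex square root $\Delta$ of $s^2+r^3$ with $\Delta\ne0$, a sign $\varepsilon=\pm1$ and a complex $w$ with $w^3=-s+\varepsilon\Delta$, put $$H=\frac1{2w\Delta}\left[-(\alpha w^3+2r\alpha^2+r^2)A+(w^3+r\alpha)E+rI\right],\qquad J_{\alpha\beta\mu\nu}=2(H_{\alpha\mu\beta\nu}-H_{\alpha\nu\beta\mu}),$$ and let $W_0=\sqrt t\,\mathrm{Re}(J-\mathrm i*J)=\sqrt t\,(\mathrm{Re}\,J+*\,\mathrm{Im}\,J)$. Then $t>0$, symmetric $X$ with $s^2+r^3\neq0$ exist, and every Weyl tensor $W$ with BR tensor $T$ has an orthonormal frame of self-dual eigenbivectors. (That is, self-dual bivectors $\mathcal U_1,\mathcal U_2,\mathcal U_3$, normalised by $\frac12(\mathcal U_i)_{\alpha\beta}(\mathcal U_j)^{\alpha\beta}=-\delta_{ij}$, each an eigenvector of $F_{\alpha\beta}\mapsto\frac12\mathcal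 W_{\alpha\beta}{}^{\mu\nu}F_{\mu\nu}$.) Moreover, for every real symmetric $X$ with $s^2+r^3\ne0$ and every square root $\Delta$ of $s^2+r^3$: 1. For both signs $\varepsilon$ and every $w$ with $w^3=-s+\varepsilon\Delta$: $w\neq0$. For every Weyl tensor $W$ with BR tensor $T$ and every orthonormal frame $\{\mathcal U_i\}$ of its self-dual eigenbivectors, with $\Pi_i=\mathcal U_i\cdot\overline{\mathcal U}_i$ (that is, $(\Pi_i)_{\alpha\beta}=(\mathcal U_i)_\alpha{}^\mu(\overline{\mathcal U}_i)_{\mu\beta}$), one has $H=\varepsilon\sum_{i=1}^3\lambda_i\,\Pi_i\otimes\Pi_i$, where $\lambda_1,\lambda_2,\lambda_3$ are the three cube roots of unity in some order. The tensor $W_0$ is a Weyl tensor and has the same self-dual part as $\sqrt t\,J$. 2. For exactly one of the two signs $\varepsilon$ the following holds for every $w$ with $w^3=-s+\varepsilon\Delta$: a Weyl tensor $W$ has BR tensor $T$ if and only if $$W=\cos\theta\,W_0+\sin\theta\,*W_0\qquad\text{for some real }\theta .$$ -/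

import Mathlib

/-!
Algebra of Weyl and Bel-Robinson tensors at a point of an oriented space-time of signature
`(-,+,+,+)`. Every tensor is given by its covariant components in a positively oriented
orthonormal frame `e 0, e 1, e 2, e 3`, with `e 0` time-like. In such a frame an index is raised
by multiplying with the sign `sg`.
-/

namespace BelRobinson

/-- Components of covariant tensors of rank 2 and 4. -/
abbrev Tens2 (R : Type) := Fin 4 → Fin 4 → R

abbrev Tens4 (R : Type) := Fin 4 → Fin 4 → Fin 4 → Fin 4 → R

/-- The diagonal entries `-1, 1, 1, 1` of the metric (and of its inverse). -/
def sg (R : Type) [Field R] (a : Fin 4) : R := if a = 0 then -1 else 1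

/-- The metric. -/
def metric (R : Type) [Field R] : Tens2 R := fun a b => if a = b then sg R a else 0

/-- The metric volume element `η = e₀ ∧ e₁ ∧ e₂ ∧ e₃`: its contravariant component `0123` is `1`,
hence its covariant component `0123` is `-1`. The determinant is that of the rows `a, b, c, d` of
the identity matrix, the Levi-Civita symbol. -/
def vol (R : Type) [Field R] : Tens4 R := fun a b c d =>
  -((1 : Matrix (Fin 4) (Fin 4) R).submatrix ![a, b, c, d] id).det

/-- Hodge dual of a 2-form, `(*F)_{ab} = ½ η_{ab}^{mn} F_{mn}`. -/
def hodge2 {R : Type} [Field R] (F : Tens2 R) : Tens2 R := fun a b =>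
  1 / 2 * ∑ m, ∑ n, vol R a b m n * sg R m * sg R n * F m n

/-- Hodge dual of a double 2-form, `(*W)_{abcd} = ½ η_{ab}^{mn} W_{mncd}`. -/
def hodge {R : Type} [Field R] (W : Tens4 R) : Tens4 R := fun a b c d =>
  1 / 2 * ∑ m, ∑ n, vol R a b m n * sg R m * sg R n * W m n c d

/-- Weyl tensors: real 4-tensors with the symmetries of a Riemann tensor and without trace. -/
structure IsWeyl (W : Tens4 ℝ) : Prop where
  antisymm : ∀ a b c d, W b a c d = -W a b c d
  pair_symm : ∀ a b c d, W c d a b = W a b c d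
  bianchi : ∀ a b c d, W a b c d + W a c d b + W a d b c = 0
  traceless : ∀ b d, ∑ a, sg ℝ a * W a b a d = 0

/-- The Bel-Robinson tensor of `W`,
`T_{ambn} = ¼ (W_a^r_b^s W_{mrns} + (*W)_a^r_b^s (*W)_{mrns})`. -/
noncomputable def belRobinson (W : Tens4 ℝ) : Tens4 ℝ := fun a m b n =>
  1 / 4 * ∑ r, ∑ s, sg ℝ r * sg ℝ s *
    (W a r b s * W m r n s + hodge W a r b s * hodge W m r n s)

/-- `T` is a Bel-Robinson tensor. -/
def IsBelRobinson (T : Tens4 ℝ) : Prop := ∃ W, IsWeyl W ∧ belRobinson W = T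

/-- Composition `(T • R)_{abcd} = T_{ab}^{mn} R_{mncd}` of endomorphisms of symmetric tensors. -/
noncomputable def comp (T R : Tens4 ℝ) : Tens4 ℝ := fun a b c d =>
  ∑ m, ∑ n, sg ℝ m * sg ℝ n * T a b m n * R m n c d

/-- The trace `T^{ab}_{ab}` of an endomorphism of symmetric tensors. -/
noncomputable def Tr (T : Tens4 ℝ) : ℝ := ∑ a, ∑ b, sg ℝ a * sg ℝ b * T a b a b

/-! ### The concomitants `A`, `B`, `C` and the scalars and tensors built from them -/

/-- `A = (T/t + T²/t² + T³/t³) / 3`. -/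
noncomputable def concA (T : Tens4 ℝ) (t : ℝ) : Tens4 ℝ := fun a b c d =>
  1 / 3 * (T a b c d / t + comp T T a b c d / t ^ 2 + comp (comp T T) T a b c d / t ^ 3)

/-- `B_{abcdlm} = 2 A_{abl}^e A_{cdme} - ½ A_{abcd} g_{lm}`. -/
noncomputable def concB (A : Tens4 ℝ) (a b c d l m : Fin 4) : ℝ :=
  2 * ∑ e, sg ℝ e * A a b l e * A c d m e - 1 / 2 * A a b c d * metric ℝ l m

/-- `C_{abcdlmnr} = 2 A_{abn}^e B_{cdlmre} - ½ B_{abcdlm} g_{nr}`. -/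
noncomputable def concC (A : Tens4 ℝ) (a b c d l m n r : Fin 4) : ℝ :=
  2 * ∑ e, sg ℝ e * A a b n e * concB A c d l m r e - 1 / 2 * concB A a b c d l m * metric ℝ n r

/-- The contravariant components of a rank 2 tensor. -/
noncomputable def up (X : Tens2 ℝ) : Tens2 ℝ := fun a b => sg ℝ a * sg ℝ b * X a b

/-- Full contraction `Y_{ab} X^{ab}`. -/
noncomputable def contr (Y X : Tens2 ℝ) : ℝ := ∑ a, ∑ b, Y a b * up X a b

/-- `A(X)`. -/
noncomputable def AX (A : Tens4 ℝ) (X : Tens2 ℝ) : Tens2 ℝ := fun a b => ∑ c, ∑ d, A a b c d * up X c d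

/-- `B(X)`. -/
noncomputable def BX (A : Tens4 ℝ) (X : Tens2 ℝ) : Tens4 ℝ := fun a b c d =>
  ∑ l, ∑ m, concB A a b c d l m * up X l m

/-- `B(X,X)`. -/
noncomputable def BXX (A : Tens4 ℝ) (X : Tens2 ℝ) : Tens2 ℝ := fun a b =>
  ∑ c, ∑ d, BX A X a b c d * up X c d

/-- `C(X,X)_{abnr} = C_{abcdlmnr} X^{cd} X^{lm}`: with the index order of `concC`, `X` fills the
second and the third pair of indices. -/
noncomputable def CXX (A : Tens4 ℝ) (X : Tens2 ℝ) : Tens4 ℝ := fun a b n r =>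
  ∑ c, ∑ d, ∑ l, ∑ m, concC A a b c d l m n r * up X c d * up X l m

/-- `α = A(X,X)/3`. -/
noncomputable def scalAlpha (A : Tens4 ℝ) (X : Tens2 ℝ) : ℝ := 1 / 3 * contr (AX A X) X

/-- `β = B(X,X,X)/6`. -/
noncomputable def scalBeta (A : Tens4 ℝ) (X : Tens2 ℝ) : ℝ := 1 / 6 * contr (BXX A X) X

/-- `γ = C(X,X,X,X)/12`. -/
noncomputable def scalGamma (A : Tens4 ℝ) (X : Tens2 ℝ) : ℝ :=
  1 / 12 * contr (fun a b => ∑ n, ∑ r, CXX A X a b n r * up X n r) X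

/-- `r = γ - α²`. -/
noncomputable def scalR (A : Tens4 ℝ) (X : Tens2 ℝ) : ℝ := scalGamma A X - scalAlpha A X ^ 2

/-- `s = (3αγ - β²)/2 - α³`. -/
noncomputable def scalS (A : Tens4 ℝ) (X : Tens2 ℝ) : ℝ :=
  1 / 2 * (3 * scalAlpha A X * scalGamma A X - scalBeta A X ^ 2) - scalAlpha A X ^ 3

/-- `E = A(X) ⊗ A(X) - ½ C(X,X)`. -/
noncomputable def tensE (A : Tens4 ℝ) (X : Tens2 ℝ) : Tens4 ℝ := fun a b c d =>
  AX A X a b * AX A X c d - 1 / 2 * CXX A X a b c d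

/-- `I = ¼ B(X,X) ⊗ B(X,X) - β B(X)`. -/
noncomputable def tensI (A : Tens4 ℝ) (X : Tens2 ℝ) : Tens4 ℝ := fun a b c d =>
  1 / 4 * (BXX A X a b * BXX A X c d) - scalBeta A X * BX A X a b c d

/-- `H = (1/(2wΔ)) [-(αw³ + 2rα² + r²) A + (w³ + rα) E + r I]`, a complex tensor. -/
noncomputable def tensH (A : Tens4 ℝ) (X : Tens2 ℝ) (Δ w : ℂ) : Tens4 ℂ := fun a b c d =>
  1 / (2 * w * Δ) *
    (-(scalAlpha A X * w ^ 3 + 2 * scalR A X * scalAlpha A X ^ 2 + scalR A X ^ 2) * A a b c d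
      + (w ^ 3 + scalR A X * scalAlpha A X) * tensE A X a b c d
      + scalR A X * tensI A X a b c d)

/-- `J_{abmn} = 2 (H_{ambn} - H_{anbm})`. -/
def tensJ (H : Tens4 ℂ) : Tens4 ℂ := fun a b m n => 2 * (H a m b n - H a n b m)

/-! ### Self-dual tensors -/

/-- A real tensor seen as a complex one. -/
def toComplex (W : Tens4 ℝ) : Tens4 ℂ := fun a b c d => (W a b c d : ℂ)

/-- The self-dual part `½ (W - i *W)` of a double 2-form. -/
noncomputable def selfDualPart (W : Tens4 ℂ) : Tens4 ℂ := fun a b c d =>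
  1 / 2 * (W a b c d - Complex.I * hodge W a b c d)

/-- Self-dual bivectors: complex 2-forms `F` with `*F = i F`. -/
structure IsSDBivector (F : Tens2 ℂ) : Prop where
  antisymm : ∀ a b, F b a = -F a b
  selfDual : ∀ a b, hodge2 F a b = Complex.I * F a b

/-- The metric of the space of self-dual bivectors, `½ F_{ab} K^{ab}`. -/
noncomputable def sdMetric (F K : Tens2 ℂ) : ℂ :=
  1 / 2 * ∑ a, ∑ b, sg ℂ a * sg ℂ b * F a b * K a b

/-- `½ S_{ab}^{mn} F_{mn}`, the action of a double 2-form `S` on a bivector `F`. -/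
noncomputable def sdApply (S : Tens4 ℂ) (F : Tens2 ℂ) : Tens2 ℂ := fun a b =>
  1 / 2 * ∑ m, ∑ n, sg ℂ m * sg ℂ n * S a b m n * F m n

/-- `U` is an orthonormal frame of self-dual eigenbivectors of the Weyl tensor `W`, that is, of
its self-dual part; orthonormal frames are normalised so that the metric of the space of self-dual
bivectors is `-∑ U i ⊗ U i`. -/
structure IsEigenframe (W : Tens4 ℝ) (U : Fin 3 → Tens2 ℂ) : Prop where
  sd : ∀ i, IsSDBivector (U i)
  orthonormal : ∀ i j, sdMetric (U i) (U j) = if i = j then -1 else 0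
  eigen : ∀ i, ∃ ρ : ℂ, ∀ a b,
    sdApply (selfDualPart (toComplex W)) (U i) a b = ρ * U i a b

/-- The eigentensor `Π = F · F̄`, `Π_{ab} = F_a^m F̄_{mb}`. -/
noncomputable def eigenTensor (F : Tens2 ℂ) : Tens2 ℂ := fun a b =>
  ∑ m, sg ℂ m * F a m * (starRingEnd ℂ) (F m b)

/-- The real tensor `W₀ = √t Re (J - i *J) = √t (Re J + * Im J)`; it is the real double 2-form
whose self-dual part is that of `√t J`. -/
noncomputable def weylZero (t : ℝ) (J : Tens4 ℂ) : Tens4 ℝ := fun a b c d =>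
  Real.sqrt t * (J a b c d - Complex.I * hodge J a b c d).re

end BelRobinson

open BelRobinson

namespace BelRobinson

open Complex (I)
open ComplexConjugate

/-! The self-dual part of a Weyl tensor is a symmetric trace-free complex 3×3 matrix `q`, and the
self-dual parts of `W` and its dual differ by the factor `i`. In `W W + *W *W` the
self-dual/self-dual terms cancel, so `T` is `4 q ⊗ q̄` acting on products of self-dual and
anti-self-dual bivectors (`belRobinson_of_dyad`, `Tr_belRobinson_of_dyad`). Hence `T` determines `q`
up to a phase, that is, `W` up to a duality rotation (`IsWeyl.phase_of_belRobinson_eq`,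
`rotation_iff`).

The trace conditions say `tr q² = 0 ≠ tr q³`, so Cayley–Hamilton makes `q³` a non-zero scalar and
`q` has an orthogonal eigenframe with eigenvalues proportional to the three cube roots of unity. The
eigenvalues of `T` are then `t` times ratios of eigenvalues, and `z + z² + z³` vanishes on the
non-trivial cube roots of unity; so `A` is the projector onto the span of the three eigentensors `Π
i` (`IsFrame.concA_eq`). These satisfy `Π i Π i = g/4` and `Π i Π j = Π k/2`, which turns `B` and
`C` into symmetric expressions in them.

With `x i` the components of `X` along `Π i`, the scalars `α`, `β`, `γ` give the cubic whose roots
are `x i²`; after the shift by `α` it is `z³ + 3rz + 2s`. Cardano's formula writes `z i = λ i w - λ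
i² v`, and the combination in `H` isolates the cube root of unity `λ i`
(`IsDepressed.exists_cubeTriple`). Antisymmetrising `H` and keeping the self-dual part gives a Weyl
tensor with eigenvalues proportional to `λ i` in the frame of `W`.

What remains is the cyclic order of the `λ i`: it must match that of the eigenvalues of `W` for the
two to be proportional. `altProd` measures this order, and changing the sign `ε` reverses it, so
exactly one sign works. -/

/-! ### The volume form and the Hodge dual in components -/

/-- Permutation symbol with integer values. -/
def leviCivita (a b c d : Fin 4) : ℤ :=
  -- The Vandermonde product of 0, 1, 2, 3 is 12, so the integer division is exact and leaves the
  -- sign of the permutation, or 0.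
  (((b : ℤ) - a) * ((c : ℤ) - a) * ((d : ℤ) - a) * ((c : ℤ) - b) * ((d : ℤ) - b) * ((d : ℤ) - c)) / 12

/-- Over `ℤ` the determinant can be decided by evaluation; the ring homomorphism from `ℤ` carries
the result to every field. -/
theorem vol_eq_leviCivita (R : Type) [Field R] (a b c d : Fin 4) :
    vol R a b c d = -(leviCivita a b c d : R) := by
  have h : ((1 : Matrix (Fin 4) (Fin 4) ℤ).submatrix ![a, b, c, d] id).det
      = leviCivita a b c d := by
    revert a b c d
    decide +kernel
  have h2 := congrArg (Int.castRingHom R) h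
  rw [RingHom.map_det] at h2
  rw [vol]
  congr 1
  rw [← eq_intCast (Int.castRingHom R), ← h2]
  congr 1
  ext i j
  simp only [RingHom.mapMatrix_apply, Matrix.map_apply, Matrix.submatrix_apply, Matrix.one_apply]
  split_ifs <;> simp

theorem hodge2_values {R : Type} [Field R] [CharZero R] {F : Tens2 R}
    (hF : ∀ a b, F b a = -F a b) (a b : Fin 4) :
    hodge2 F a b = !![0, -F 2 3, F 1 3, -F 1 2; F 2 3, 0, F 0 3, -F 0 2;
      -F 1 3, -F 0 3, 0, F 0 1; F 1 2, F 0 2, -F 0 1, 0] a b := by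
  have h1 := hF 0 1
  have h2 := hF 0 2
  have h3 := hF 0 3
  have h4 := hF 1 2
  have h5 := hF 1 3
  have h6 := hF 2 3
  simp only [hodge2, vol_eq_leviCivita, Fin.sum_univ_four]
  fin_cases a <;> fin_cases b <;>
    simp [leviCivita, sg, h1, h2, h3, h4, h5, h6] <;> ring

/-! ### Self-dual and anti-self-dual bivectors and their products -/

/-- The self-dual bivector with electric part `f`. -/
noncomputable def sd (f : Fin 3 → ℂ) : Tens2 ℂ :=
  !![0, f 0, f 1, f 2; -f 0, 0, -I * f 2, I * f 1; -f 1, I * f 2, 0, -I * f 0;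
    -f 2, -I * f 1, I * f 0, 0]

/-- The anti-self-dual bivector with electric part `f`. -/
noncomputable def asd (f : Fin 3 → ℂ) : Tens2 ℂ :=
  !![0, f 0, f 1, f 2; -f 0, 0, I * f 2, -I * f 1; -f 1, -I * f 2, 0, I * f 0;
    -f 2, I * f 1, -I * f 0, 0]

/-- The product of a self-dual and an anti-self-dual bivector. -/
noncomputable def mixed (f h : Fin 3 → ℂ) : Tens2 ℂ :=
  fun a b => ∑ m, sg ℂ m * sd f a m * asd h m b

theorem mixed_values (f h : Fin 3 → ℂ) (a b : Fin 4) : mixed f h a b =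
    !![-f 0 * h 0 - f 1 * h 1 - f 2 * h 2, I * (f 2 * h 1 - f 1 * h 2),
          I * (f 0 * h 2 - f 2 * h 0), I * (f 1 * h 0 - f 0 * h 1);
       I * (f 2 * h 1 - f 1 * h 2), f 0 * h 0 - f 1 * h 1 - f 2 * h 2,
          f 0 * h 1 + f 1 * h 0, f 0 * h 2 + f 2 * h 0;
       I * (f 0 * h 2 - f 2 * h 0), f 0 * h 1 + f 1 * h 0,
          f 1 * h 1 - f 0 * h 0 - f 2 * h 2, f 1 * h 2 + f 2 * h 1;
       I * (f 1 * h 0 - f 0 * h 1), f 0 * h 2 + f 2 * h 0, f 1 * h 2 + f 2 * h 1,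
          f 2 * h 2 - f 0 * h 0 - f 1 * h 1] a b := by
  simp only [mixed, Fin.sum_univ_four]
  fin_cases a <;> fin_cases b <;> simp [sd, asd, sg] <;> ring_nf <;> simp <;> ring

theorem mixed_symm (f h : Fin 3 → ℂ) (a b : Fin 4) : mixed f h b a = mixed f h a b := by
  rw [mixed_values, mixed_values]
  fin_cases a <;> fin_cases b <;> rfl

theorem sd_antisymm (f : Fin 3 → ℂ) (a b : Fin 4) : sd f b a = -sd f a b := by
  fin_cases a <;> fin_cases b <;> simp [sd]

theorem asd_antisymm (f : Fin 3 → ℂ) (a b : Fin 4) : asd f b a = -asd f a b := by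
  fin_cases a <;> fin_cases b <;> simp [asd]

theorem conj_sd (f : Fin 3 → ℂ) (a b : Fin 4) : conj (sd f a b) = asd (fun i => conj (f i)) a b := by
  fin_cases a <;> fin_cases b <;> simp [sd, asd]

theorem conj_asd (f : Fin 3 → ℂ) (a b : Fin 4) : conj (asd f a b) = sd (fun i => conj (f i)) a b := by
  fin_cases a <;> fin_cases b <;> simp [sd, asd]

theorem conj_sg (a : Fin 4) : conj (sg ℂ a) = sg ℂ a := by
  unfold sg; split_ifs <;> simp

theorem ofReal_sg (a : Fin 4) : ((sg ℝ a : ℝ) : ℂ) = sg ℂ a := by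
  unfold sg; split_ifs <;> simp

theorem conj_mixed (f h : Fin 3 → ℂ) (a b : Fin 4) :
    conj (mixed f h a b) = mixed (fun i => conj (h i)) (fun i => conj (f i)) a b := by
  rw [← mixed_symm]
  simp only [mixed, map_sum, map_mul, conj_sd, conj_asd, conj_sg]
  refine Finset.sum_congr rfl fun m _ => ?_
  rw [asd_antisymm _ m b, sd_antisymm _ a m]
  ring

theorem hodge2_sd (f : Fin 3 → ℂ) (a b : Fin 4) : hodge2 (sd f) a b = I * sd f a b := by
  rw [hodge2_values (sd_antisymm f)]
  fin_cases a <;> fin_cases b <;> simp [sd, ← mul_assoc]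

theorem hodge2_asd (f : Fin 3 → ℂ) (a b : Fin 4) : hodge2 (asd f) a b = -I * asd f a b := by
  rw [hodge2_values (asd_antisymm f)]
  fin_cases a <;> fin_cases b <;> simp [asd, ← mul_assoc]

theorem IsSDBivector.eq_sd {F : Tens2 ℂ} (hF : IsSDBivector F) : F = sd fun k => F 0 k.succ := by
  have h := fun a b => (hodge2_values hF.antisymm a b).symm.trans (hF.selfDual a b)
  have h1 := h 0 1
  have h2 := h 0 2
  have h3 := h 0 3
  have k : ∀ a, F a a = 0 := fun a => by
    have := hF.antisymm a a
    linear_combination (1 / 2) * this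
  simp at h1 h2 h3
  have e1 : F 2 3 = -(I * F 0 1) := by rw [← h1]; ring
  have e2 : F 1 3 = I * F 0 2 := h2
  have e3 : F 1 2 = -(I * F 0 3) := by rw [← h3]; ring
  have h4 := hF.antisymm 0 1
  have h5 := hF.antisymm 0 2
  have h6 := hF.antisymm 0 3
  have h7 := hF.antisymm 1 2
  have h8 := hF.antisymm 1 3
  have h9 := hF.antisymm 2 3
  rw [e1] at h9
  rw [e2] at h8
  rw [e3] at h7
  ext a b
  fin_cases a <;> fin_cases b <;> simp [sd, k, e1, e2, e3, h4, h5, h6, h7, h8, h9]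

theorem isSDBivector_sd (f : Fin 3 → ℂ) : IsSDBivector (sd f) :=
  ⟨sd_antisymm f, hodge2_sd f⟩

theorem eigenTensor_sd (f : Fin 3 → ℂ) (a b : Fin 4) :
    eigenTensor (sd f) a b = mixed f (fun i => conj (f i)) a b := by
  simp only [eigenTensor, mixed, conj_sd]

theorem sdMetric_sd (f h : Fin 3 → ℂ) : sdMetric (sd f) (sd h) = -2 * f ⬝ᵥ h := by
  simp only [sdMetric, Fin.sum_univ_four, dotProduct, Fin.sum_univ_three]
  simp [sd, sg]
  linear_combination (f 0 * h 0 + f 1 * h 1 + f 2 * h 2) * (Complex.I_sq)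

theorem contr_mixed (f h f' h' : Fin 3 → ℂ) :
    ∑ a, ∑ b, sg ℂ a * sg ℂ b * mixed f h a b * mixed f' h' a b
      = 4 * (f ⬝ᵥ f') * (h ⬝ᵥ h') := by
  simp only [mixed_values, Fin.sum_univ_four, dotProduct, Fin.sum_univ_three]
  simp [sg]
  ring_nf
  simp
  ring

theorem mixed_mul_mixed_self {f h : Fin 3 → ℂ} (l m : Fin 4) :
    ∑ e, sg ℂ e * mixed f h l e * mixed f h m e
      = (f ⬝ᵥ f) * (h ⬝ᵥ h) * metric ℂ l m := by
  simp only [mixed_values, Fin.sum_univ_four, dotProduct, Fin.sum_univ_three, metric]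
  fin_cases l <;> fin_cases m <;> simp [sg] <;> ring_nf <;> simp <;> ring

/-- Self-dual bivectors commute with anti-self-dual ones, and each family multiplies like
quaternions: a dot product plus a multiple of a cross product. The four terms come from multiplying
out the two such products. -/
theorem mixed_mul_mixed {f h f' h' : Fin 3 → ℂ} (l m : Fin 4) :
    ∑ e, sg ℂ e * mixed f h l e * mixed f' h' m e =
      (f ⬝ᵥ f') * (h ⬝ᵥ h') * metric ℂ l m + I * (h ⬝ᵥ h') * sd (crossProduct f f') l m
      - I * (f ⬝ᵥ f') * asd (crossProduct h h') l m
      + mixed (crossProduct f f') (crossProduct h h') l m := by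
  simp only [mixed_values, Fin.sum_univ_four, dotProduct, Fin.sum_univ_three, metric, cross_apply]
  fin_cases l <;> fin_cases m <;> simp [sg, sd, asd] <;> ring_nf <;> simp <;> ring

set_option maxHeartbeats 4000000 in
-- This is what lets `J` return to double 2-forms: antisymmetrising an eigentensor squared separates
-- a self-dual dyad, an anti-self-dual dyad and a pure metric term.
theorem mixed_wedge (f h : Fin 3 → ℂ) (a b m n : Fin 4) :
    mixed f h a m * mixed f h b n - mixed f h a n * mixed f h b m =
      -(h ⬝ᵥ h) * (sd f a b * sd f m n) - (f ⬝ᵥ f) * (asd h a b * asd h m n)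
      - (f ⬝ᵥ f) * (h ⬝ᵥ h) * (metric ℂ a m * metric ℂ b n - metric ℂ a n * metric ℂ b m) := by
  simp only [mixed_values, dotProduct, Fin.sum_univ_three, metric]
  fin_cases a <;> fin_cases b <;> fin_cases m <;> fin_cases n <;>
    simp [sg, sd, asd] <;> ring_nf <;> simp <;> ring

/-! ### The Hodge dual of Weyl tensors -/

theorem hodge2_linear {R : Type} [Field R] (x y : R) (F K : Tens2 R) (a b : Fin 4) :
    hodge2 (fun m n => x * F m n + y * K m n) a b = x * hodge2 F a b + y * hodge2 K a b := by
  simp only [hodge2, Finset.mul_sum, ← Finset.sum_add_distrib]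
  refine Finset.sum_congr rfl fun m _ => Finset.sum_congr rfl fun n _ => ?_
  ring

theorem hodge2_antisymm {R : Type} [Field R] [CharZero R] {F : Tens2 R}
    (hF : ∀ a b, F b a = -F a b) (a b : Fin 4) : hodge2 F b a = -hodge2 F a b := by
  rw [hodge2_values hF, hodge2_values hF]
  fin_cases a <;> fin_cases b <;> simp

theorem hodge2_hodge2 {R : Type} [Field R] [CharZero R] {F : Tens2 R}
    (hF : ∀ a b, F b a = -F a b) (a b : Fin 4) : hodge2 (hodge2 F) a b = -F a b := by
  have k : ∀ a, F a a = 0 := fun a => by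
    have := hF a a
    have h2 : 2 * F a a = 0 := by linear_combination this
    simpa using h2
  rw [hodge2_values (hodge2_antisymm hF)]
  simp only [hodge2_values hF]
  have h1 := hF 0 1
  have h2 := hF 0 2
  have h3 := hF 0 3
  have h4 := hF 1 2
  have h5 := hF 1 3
  have h6 := hF 2 3
  fin_cases a <;> fin_cases b <;> simp [k, h1, h2, h3, h4, h5, h6]

theorem hodge_eq_hodge2 {R : Type} [Field R] (W : Tens4 R) (a b c d : Fin 4) :
    hodge W a b c d = hodge2 (fun m n => W m n c d) a b := rfl

theorem hodge2_ofReal (F : Tens2 ℝ) (a b : Fin 4) :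
    hodge2 (fun m n => (F m n : ℂ)) a b = (hodge2 F a b : ℝ) := by
  simp [hodge2, vol_eq_leviCivita, ofReal_sg]

theorem hodge_toComplex (W : Tens4 ℝ) (a b c d : Fin 4) :
    hodge (toComplex W) a b c d = (hodge W a b c d : ℝ) :=
  hodge2_ofReal _ a b

theorem forall_pair_of_antisymm {P : Fin 4 → Fin 4 → Prop} (hd : ∀ a, P a a)
    (hs : ∀ a b, P a b → P b a) (h : ∀ a b, a < b → P a b) (a b : Fin 4) : P a b := by
  rcases lt_trichotomy a b with h1 | h1 | h1
  · exact h a b h1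
  · exact h1 ▸ hd a
  · exact hs _ _ (h b a h1)

theorem IsWeyl.antisymm' {W : Tens4 ℝ} (hW : IsWeyl W) (a b c d : Fin 4) :
    W a b d c = -W a b c d := by
  rw [← hW.pair_symm, hW.antisymm, hW.pair_symm]

theorem IsWeyl.diag {W : Tens4 ℝ} (hW : IsWeyl W) (a c d : Fin 4) : W a a c d = 0 := by
  linarith [hW.antisymm a a c d]

theorem IsWeyl.diag' {W : Tens4 ℝ} (hW : IsWeyl W) (a c d : Fin 4) : W c d a a = 0 := by
  rw [← hW.pair_symm, hW.diag]

theorem IsWeyl.hodge_antisymm {W : Tens4 ℝ} (hW : IsWeyl W) (a b c d : Fin 4) :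
    hodge W b a c d = -hodge W a b c d :=
  hodge2_antisymm (fun a b => hW.antisymm a b c d) a b

theorem IsWeyl.hodge_antisymm' {W : Tens4 ℝ} (hW : IsWeyl W) (a b c d : Fin 4) :
    hodge W a b d c = -hodge W a b c d := by
  simp only [hodge, hW.antisymm' _ _ c d, mul_neg, Finset.sum_neg_distrib]

/-- Given the pair symmetry of `W`, tracelessness is what makes the left and right duals agree; the
cyclic identity is not needed here. -/
theorem IsWeyl.hodge_pair_symm {W : Tens4 ℝ} (hW : IsWeyl W) (a b c d : Fin 4) :
    hodge W c d a b = hodge W a b c d := by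
  have dg : ∀ a c d, hodge W a a c d = 0 := fun a c d => by
    linarith [hW.hodge_antisymm a a c d]
  have dg' : ∀ a c d, hodge W c d a a = 0 := fun a c d => by
    linarith [hW.hodge_antisymm' c d a a]
  revert a b
  apply forall_pair_of_antisymm
  · intro a; rw [dg, dg']
  · intro a b h
    rw [hW.hodge_antisymm' c d a b, h, hW.hodge_antisymm a b]
  intro a b hab
  revert c d
  apply forall_pair_of_antisymm
  · intro a; rw [dg, dg']
  · intro c d h
    rw [hW.hodge_antisymm' a b c d, hW.hodge_antisymm c d, h]
  intro c d hcd
  have t : ∀ b d, -W 0 b 0 d + W 1 b 1 d + W 2 b 2 d + W 3 b 3 d = 0 := fun b d => by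
    have := hW.traceless b d
    simp only [Fin.sum_univ_four, sg] at this
    simpa using this
  have s1 := fun c d => hW.antisymm 0 1 c d
  have s2 := fun c d => hW.antisymm 0 2 c d
  have s3 := fun c d => hW.antisymm 0 3 c d
  have s4 := fun c d => hW.antisymm 1 2 c d
  have s5 := fun c d => hW.antisymm 1 3 c d
  have s6 := fun c d => hW.antisymm 2 3 c d
  have r1 := fun c d => hW.antisymm' c d 0 1
  have r2 := fun c d => hW.antisymm' c d 0 2
  have r3 := fun c d => hW.antisymm' c d 0 3
  have r4 := fun c d => hW.antisymm' c d 1 2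
  have r5 := fun c d => hW.antisymm' c d 1 3
  have r6 := fun c d => hW.antisymm' c d 2 3
  have t00 := t 0 0
  have t01 := t 0 1
  have t02 := t 0 2
  have t03 := t 0 3
  have t11 := t 1 1
  have t12 := t 1 2
  have t13 := t 1 3
  have t22 := t 2 2
  have t23 := t 2 3
  have t33 := t 3 3
  have p1 := hW.pair_symm 0 1 0 2
  have p2 := hW.pair_symm 0 1 0 3
  have p3 := hW.pair_symm 0 1 1 2
  have p4 := hW.pair_symm 0 1 1 3
  have p5 := hW.pair_symm 0 1 2 3
  have p6 := hW.pair_symm 0 2 0 3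
  have p7 := hW.pair_symm 0 2 1 2
  have p8 := hW.pair_symm 0 2 1 3
  have p9 := hW.pair_symm 0 2 2 3
  have p10 := hW.pair_symm 0 3 1 2
  have p11 := hW.pair_symm 0 3 1 3
  have p12 := hW.pair_symm 0 3 2 3
  have p13 := hW.pair_symm 1 2 1 3
  have p14 := hW.pair_symm 1 2 2 3
  have p15 := hW.pair_symm 1 3 2 3
  simp only [s1, s2, s3, s4, s5, s6, r1, r2, r3, r4, r5, r6, hW.diag, hW.diag'] at t00 t01 t02 t03 t11 t12 t13 t22 t23 t33
  simp only [hodge_eq_hodge2, hodge2_values (fun a b => hW.antisymm a b _ _)]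
  clear t s1 s2 s3 s4 s5 s6 r1 r2 r3 r4 r5 r6 dg dg'
  -- Only ordered index pairs are left; each component is a linear consequence of the trace
  -- equations and the pair symmetry.
  fin_cases a <;> fin_cases b <;> first | exact absurd hab (by decide) | skip
  all_goals
    fin_cases c <;> fin_cases d <;> first | exact absurd hcd (by decide) | skip
  all_goals
    simp
    try linarith

/-! ### The self-dual part of a Weyl tensor as a 3×3 matrix -/

theorem isSDBivector_of_antisymm {F : Tens2 ℂ} (hF : ∀ a b, F b a = -F a b) :
    IsSDBivector fun a b => 1 / 2 * (F a b - I * hodge2 F a b) := by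
  constructor
  · intro a b
    rw [hF, hodge2_antisymm hF]
    ring
  · intro a b
    have := hodge2_linear (1 / 2) (-(1 / 2) * I) F (hodge2 F) a b
    rw [hodge2_hodge2 hF] at this
    have e : (fun a b => 1 / 2 * (F a b - I * hodge2 F a b)) =
        fun m n => (1 / 2) * F m n + (-(1 / 2) * I) * hodge2 F m n := by
      funext m n; ring
    rw [e, this]
    ring_nf
    simp
    ring

/-- The linear map `f ↦ sd f`. -/
noncomputable def sdLin : (Fin 3 → ℂ) →ₗ[ℂ] Tens2 ℂ where
  toFun := sd
  map_add' f g := by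
    ext a b
    change sd (f + g) a b = sd f a b + sd g a b
    fin_cases a <;> fin_cases b <;> simp [sd] <;> ring
  map_smul' x f := by
    ext a b
    change sd (x • f) a b = x * sd f a b
    fin_cases a <;> fin_cases b <;> simp [sd] <;> ring

theorem sd_sum {ι : Type*} [Fintype ι] (x : ι → ℂ) (f : ι → Fin 3 → ℂ) (a b : Fin 4) :
    sd (fun k => ∑ i, x i * f i k) a b = ∑ i, x i * sd (f i) a b := by
  have h := congrFun (congrFun (map_sum sdLin (fun i => x i • f i) Finset.univ) a) b
  simp only [map_smul, Finset.sum_apply, Pi.smul_apply, smul_eq_mul] at h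
  rw [show (fun k => ∑ i, x i * f i k) = ∑ i, x i • f i by
    funext k; simp]
  exact h

/-- The standard basis of `ℂ³`. -/
def stdVec (k : Fin 3) : Fin 3 → ℂ := Pi.single k 1

theorem sum_mul_stdVec (f : Fin 3 → ℂ) : (fun k => ∑ i, f i * stdVec i k) = f := by
  funext k
  simp [stdVec, Pi.single_apply]

theorem sd_eq_sum (f : Fin 3 → ℂ) (a b : Fin 4) : sd f a b = ∑ k, f k * sd (stdVec k) a b := by
  rw [← sd_sum, sum_mul_stdVec]

/-- The sum of the tensor products of the self-dual bivectors of `F i` and `G i`. -/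
noncomputable def dyad {ι : Type} [Fintype ι] (F G : ι → Fin 3 → ℂ) : Tens4 ℂ :=
  fun a b c d => ∑ i, sd (F i) a b * sd (G i) c d

theorem dyad_real_part (W : Tens4 ℝ) (a b c d : Fin 4) :
    (W a b c d : ℂ) = selfDualPart (toComplex W) a b c d
      + conj (selfDualPart (toComplex W) a b c d) := by
  have e : conj (2 : ℂ) = 2 := map_ofNat _ 2
  simp only [selfDualPart, hodge_toComplex, toComplex]
  simp [e]
  ring

/-- The pair symmetry of `W` and `*W` makes the self-dual part self-dual in both index pairs, and a
self-dual bivector is fixed by its electric part; so the components `S 0 k 0 l` suffice. -/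
theorem IsWeyl.exists_matrix {W : Tens4 ℝ} (hW : IsWeyl W) :
    ∃ q : Matrix (Fin 3) (Fin 3) ℂ, q.IsSymm ∧ q.trace = 0 ∧
      selfDualPart (toComplex W) = dyad stdVec q := by
  set S := selfDualPart (toComplex W) with hS
  have sdl : ∀ c d, IsSDBivector fun a b => S a b c d := fun c d =>
    isSDBivector_of_antisymm (F := fun a b => toComplex W a b c d) fun a b => by
      simp [toComplex, hW.antisymm a b]
  have sym : ∀ a b c d, S c d a b = S a b c d := fun a b c d => by
    simp only [hS, selfDualPart, hodge_toComplex, toComplex, hW.hodge_pair_symm a b c d,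
      hW.pair_symm a b c d]
  refine ⟨fun k l => S 0 k.succ 0 l.succ, ?_, ?_, ?_⟩
  · ext k l
    exact sym _ _ _ _
  · have t := hW.traceless 0 0
    have t2 := hW.bianchi 0 1 2 3
    have t3 := hW.antisymm' 0 2 1 3
    have p1 := hW.pair_symm 0 1 2 3
    have p2 := hW.pair_symm 0 2 1 3
    have p3 := hW.pair_symm 0 3 1 2
    simp only [Fin.sum_univ_four, hW.diag, sg] at t
    have t4 : W 0 1 0 1 + W 0 2 0 2 + W 0 3 0 3 = 0 := by
      have e1 : ∀ a, W a 0 a 0 = W 0 a 0 a := fun a => by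
        rw [hW.antisymm, hW.antisymm', neg_neg]
      simpa [e1] using t
    -- The matrix trace has two parts: that of `W` vanishes by tracelessness, that of `*W` by the
    -- cyclic identity.
    have t5 : hodge W 0 1 0 1 + hodge W 0 2 0 2 + hodge W 0 3 0 3 = 0 := by
      simp only [hodge_eq_hodge2, hodge2_values (fun a b => hW.antisymm a b _ _)]
      simp
      linarith
    have t4' := congrArg (fun x : ℝ => (x : ℂ)) t4
    have t5' := congrArg (fun x : ℝ => (x : ℂ)) t5
    push_cast at t4' t5'
    simp only [Matrix.trace, Matrix.diag, Fin.sum_univ_three, hS, selfDualPart, hodge_toComplex,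
      toComplex]
    change 1 / 2 * (((W 0 1 0 1 : ℝ) : ℂ) - I * (hodge W 0 1 0 1 : ℝ))
      + 1 / 2 * (((W 0 2 0 2 : ℝ) : ℂ) - I * (hodge W 0 2 0 2 : ℝ))
      + 1 / 2 * (((W 0 3 0 3 : ℝ) : ℂ) - I * (hodge W 0 3 0 3 : ℝ)) = 0
    linear_combination 1 / 2 * t4' - 1 / 2 * I * t5'
  · funext a b c d
    have h1 : S a b c d = ∑ k : Fin 3, S 0 k.succ c d * sd (stdVec k) a b := by
      rw [← sd_eq_sum]
      exact congrFun (congrFun (sdl c d).eq_sd a) b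
    have h2 : ∀ k : Fin 3, S 0 k.succ c d = sd (fun l => S 0 k.succ 0 l.succ) c d := fun k => by
      rw [← sym]
      have := congrFun (congrFun (sdl 0 k.succ).eq_sd c) d
      rw [this]
      simp only [sym]
    rw [h1, dyad]
    refine Finset.sum_congr rfl fun k _ => ?_
    rw [h2, mul_comm]

/-! ### The Bel-Robinson tensor as a sesquilinear expression, and its traces -/

theorem sum_comm_four {ι κ μ ν M : Type*} [Fintype ι] [Fintype κ] [Fintype μ] [Fintype ν]
    [AddCommMonoid M] (f : ι → κ → μ → ν → M) :
    ∑ i, ∑ j, ∑ k, ∑ l, f i j k l = ∑ k, ∑ l, ∑ i, ∑ j, f i j k l := by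
  calc _ = ∑ i, ∑ k, ∑ j, ∑ l, f i j k l := Finset.sum_congr rfl fun i _ => Finset.sum_comm
    _ = ∑ k, ∑ i, ∑ j, ∑ l, f i j k l := Finset.sum_comm
    _ = ∑ k, ∑ i, ∑ l, ∑ j, f i j k l :=
        Finset.sum_congr rfl fun k _ => Finset.sum_congr rfl fun i _ => Finset.sum_comm
    _ = _ := Finset.sum_congr rfl fun k _ => Finset.sum_comm

theorem conj_dyad {ι : Type} [Fintype ι] (F G : ι → Fin 3 → ℂ) (a b c d : Fin 4) :
    conj (dyad F G a b c d) =
      ∑ i, asd (fun k => conj (F i k)) a b * asd (fun k => conj (G i k)) c d := by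
  simp only [dyad, map_sum, map_mul, conj_sd]

theorem ofReal_hodge (W : Tens4 ℝ) (a b c d : Fin 4) :
    ((hodge W a b c d : ℝ) : ℂ) = I * (selfDualPart (toComplex W) a b c d
      - conj (selfDualPart (toComplex W) a b c d)) := by
  have e : conj (2 : ℂ) = 2 := map_ofNat _ 2
  simp only [selfDualPart, hodge_toComplex, toComplex]
  simp [e]
  ring_nf
  simp

theorem contract_sd_asd {ι κ : Type} [Fintype ι] [Fintype κ] (F G : ι → Fin 3 → ℂ)
    (F' G' : κ → Fin 3 → ℂ) (a m b n : Fin 4) :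
    ∑ r, ∑ s, sg ℂ r * sg ℂ s * ((∑ i, sd (F i) a r * sd (G i) b s) *
      (∑ j, asd (F' j) m r * asd (G' j) n s)) =
      ∑ i, ∑ j, mixed (F i) (F' j) a m * mixed (G i) (G' j) b n := by
  simp only [mixed, Finset.sum_mul_sum]
  simp only [Finset.mul_sum]
  rw [sum_comm_four]
  refine Finset.sum_congr rfl fun i _ => Finset.sum_congr rfl fun j _ =>
    Finset.sum_congr rfl fun r _ => Finset.sum_congr rfl fun s _ => ?_
  rw [asd_antisymm _ m r, asd_antisymm _ n s]
  ring

/-- With `W = S + S̄` and `*W = i (S - S̄)`, the products `S S` and `S̄ S̄` cancel and the cross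
terms double. The two cross terms agree because `mixed` is symmetric. -/
theorem belRobinson_of_dyad {W : Tens4 ℝ} {ι : Type} [Fintype ι] {F G : ι → Fin 3 → ℂ}
    (hW : selfDualPart (toComplex W) = dyad F G) (a m b n : Fin 4) :
    (belRobinson W a m b n : ℂ) = ∑ i, ∑ j, mixed (F i) (fun k => conj (F j k)) a m *
      mixed (G i) (fun k => conj (G j k)) b n := by
  have h1 := contract_sd_asd F G (fun j k => conj (F j k)) (fun j k => conj (G j k)) a m b n
  have h2 := contract_sd_asd F G (fun j k => conj (F j k)) (fun j k => conj (G j k)) m a n b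
  simp only [mixed_symm _ _ a m, mixed_symm _ _ b n] at h2
  have e : (belRobinson W a m b n : ℂ) = 1 / 2 * (
      (∑ r, ∑ s, sg ℂ r * sg ℂ s * ((∑ i, sd (F i) a r * sd (G i) b s) *
        (∑ j, asd (fun k => conj (F j k)) m r * asd (fun k => conj (G j k)) n s))) +
      ∑ r, ∑ s, sg ℂ r * sg ℂ s * ((∑ i, sd (F i) m r * sd (G i) n s) *
        (∑ j, asd (fun k => conj (F j k)) a r * asd (fun k => conj (G j k)) b s))) := by
    simp only [belRobinson]
    push_cast
    simp only [ofReal_hodge, dyad_real_part W, hW, conj_dyad, ofReal_sg]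
    simp only [dyad]
    rw [← Finset.sum_add_distrib, Finset.mul_sum, Finset.mul_sum]
    refine Finset.sum_congr rfl fun r _ => ?_
    rw [← Finset.sum_add_distrib, Finset.mul_sum, Finset.mul_sum]
    refine Finset.sum_congr rfl fun s _ => ?_
    generalize (∑ i, sd (F i) a r * sd (G i) b s) = x
    generalize (∑ i, sd (F i) m r * sd (G i) n s) = x'
    generalize (∑ i, asd (fun k => conj (F i k)) a r * asd (fun k => conj (G i k)) b s) = y
    generalize (∑ i, asd (fun k => conj (F i k)) m r * asd (fun k => conj (G i k)) n s) = y'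
    ring_nf
    simp only [Complex.I_sq]
    ring
  rw [e, h1, h2]
  ring

/-- Contraction of complex tensors of rank 2. -/
noncomputable def contrC (P Q : Tens2 ℂ) : ℂ := ∑ a, ∑ b, sg ℂ a * sg ℂ b * P a b * Q a b

theorem comp_of_sum {κ : Type} [Fintype κ] {T R : Tens4 ℝ} {P Q P' Q' : κ → Tens2 ℂ}
    (hT : ∀ a b c d, (T a b c d : ℂ) = ∑ k, P k a b * Q k c d)
    (hR : ∀ a b c d, (R a b c d : ℂ) = ∑ k, P' k a b * Q' k c d) (a b c d : Fin 4) :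
    (comp T R a b c d : ℂ) = ∑ k, P k a b * ∑ l, contrC (Q k) (P' l) * Q' l c d := by
  simp only [comp]
  push_cast
  simp only [hT, hR, ofReal_sg, contrC, Finset.mul_sum, Finset.sum_mul]
  have := sum_comm_four (fun m n l k => sg ℂ m * sg ℂ n * (P k a b * Q k m n) *
    (P' l m n * Q' l c d))
  rw [this, Finset.sum_comm]
  refine Finset.sum_congr rfl fun i _ => Finset.sum_congr rfl fun j _ =>
    Finset.sum_congr rfl fun r _ => Finset.sum_congr rfl fun s _ => ?_
  ring

theorem Tr_of_sum {κ : Type} [Fintype κ] {T : Tens4 ℝ} {P Q : κ → Tens2 ℂ}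
    (hT : ∀ a b c d, (T a b c d : ℂ) = ∑ k, P k a b * Q k c d) :
    (Tr T : ℂ) = ∑ k, contrC (Q k) (P k) := by
  simp only [Tr]
  push_cast
  simp only [hT, ofReal_sg, contrC, Finset.mul_sum]
  calc _ = ∑ a, ∑ k, ∑ b, sg ℂ a * sg ℂ b * (P k a b * Q k a b) :=
        Finset.sum_congr rfl fun i _ => Finset.sum_comm
    _ = ∑ k, ∑ a, ∑ b, sg ℂ a * sg ℂ b * (P k a b * Q k a b) := Finset.sum_comm
    _ = _ := Finset.sum_congr rfl fun i _ => Finset.sum_congr rfl fun j _ =>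
        Finset.sum_congr rfl fun r _ => by ring

theorem contrC_sum {κ : Type} [Fintype κ] (x : κ → ℂ) (Q : κ → Tens2 ℂ) (P : Tens2 ℂ) :
    contrC (fun c d => ∑ l, x l * Q l c d) P = ∑ l, x l * contrC (Q l) P := by
  simp only [contrC, Finset.mul_sum, Finset.sum_mul]
  calc _ = ∑ a, ∑ k, ∑ b, sg ℂ a * sg ℂ b * (x k * Q k a b) * P a b :=
        Finset.sum_congr rfl fun i _ => Finset.sum_comm
    _ = ∑ k, ∑ a, ∑ b, sg ℂ a * sg ℂ b * (x k * Q k a b) * P a b := Finset.sum_comm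
    _ = _ := Finset.sum_congr rfl fun i _ => Finset.sum_congr rfl fun j _ =>
        Finset.sum_congr rfl fun r _ => by ring

theorem Tr_comp_of_sum {κ : Type} [Fintype κ] {T : Tens4 ℝ} {P Q : κ → Tens2 ℂ}
    (hT : ∀ a b c d, (T a b c d : ℂ) = ∑ k, P k a b * Q k c d) {N : Matrix κ κ ℂ}
    (hN : ∀ k l, contrC (Q k) (P l) = N k l) :
    (Tr (comp T T) : ℂ) = (N * N).trace ∧ (Tr (comp (comp T T) T) : ℂ) = (N * N * N).trace := by
  have h2 := comp_of_sum hT hT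
  have h3 := comp_of_sum h2 hT
  rw [Tr_of_sum h2, Tr_of_sum h3]
  simp only [contrC_sum, hN, Matrix.trace, Matrix.diag, Matrix.mul_apply, and_self]

/-- Composition of `T` becomes multiplication of the Kronecker product `4 q ⊗ q̄`, whose traces
factor; the 4 is that of `contr_mixed`. -/
theorem Tr_belRobinson_of_dyad {W : Tens4 ℝ} {q : Matrix (Fin 3) (Fin 3) ℂ}
    (h : selfDualPart (toComplex W) = dyad stdVec q) :
    (Tr (comp (belRobinson W) (belRobinson W)) : ℂ) =
      16 * ((q * q).trace * conj (q * q).trace) ∧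
    (Tr (comp (comp (belRobinson W) (belRobinson W)) (belRobinson W)) : ℂ) =
      64 * ((q * q * q).trace * conj (q * q * q).trace) := by
  have hT : ∀ a b c d, (belRobinson W a b c d : ℂ) = ∑ k : Fin 3 × Fin 3,
      mixed (stdVec k.1) (stdVec k.2) a b * mixed (q k.1) (fun i => conj (q k.2 i)) c d := by
    intro a b c d
    rw [belRobinson_of_dyad h, Fintype.sum_prod_type]
    have e : ∀ j, (fun k => conj (stdVec j k)) = stdVec j := fun j => by
      funext k
      simp only [stdVec, Pi.single_apply]
      split_ifs <;> simp
    simp only [e]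
  set Q := q.map (starRingEnd ℂ) with hQ
  have hN : ∀ k l : Fin 3 × Fin 3,
      contrC (mixed (q k.1) (fun i => conj (q k.2 i))) (mixed (stdVec l.1) (stdVec l.2))
        = ((4 : ℂ) • Matrix.kronecker q Q) k l := by
    intro k l
    rw [contrC, contr_mixed]
    simp [stdVec, hQ, Matrix.kronecker, mul_assoc]
  obtain ⟨h2, h3⟩ := Tr_comp_of_sum hT hN
  rw [h2, h3]
  have e2 : Q * Q = (q * q).map (starRingEnd ℂ) := by rw [Matrix.map_mul]
  have e3 : (q * q).map (starRingEnd ℂ) * Q = (q * q * q).map (starRingEnd ℂ) := by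
    rw [Matrix.map_mul (L := q * q)]
  have tr : ∀ M : Matrix (Fin 3) (Fin 3) ℂ, (M.map (starRingEnd ℂ)).trace = conj M.trace :=
    fun M => by simp [Matrix.trace]
  simp only [Matrix.smul_mul, Matrix.mul_smul, Matrix.kronecker, ← Matrix.mul_kronecker_mul,
    Matrix.trace_smul, Matrix.trace_kronecker, e2, e3, tr, smul_eq_mul]
  constructor <;> ring

/-! ### Eigenframes of self-dual bivectors -/

theorem cube_eq_of_traces {q : Matrix (Fin 3) (Fin 3) ℂ} (h1 : q.trace = 0)
    (h2 : (q * q).trace = 0) : q * q * q = ((q * q * q).trace / 3) • 1 := by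
  -- Cayley–Hamilton, with the coefficients written through traces of powers by Newton's identities.
  have key : q * q * q - q.trace • (q * q) + (1 / 2 * (q.trace ^ 2 - (q * q).trace)) • q
      - (1 / 6 * (q.trace ^ 3 - 3 * q.trace * (q * q).trace + 2 * (q * q * q).trace)) • 1
      = 0 := by
    ext i j
    simp only [Matrix.trace, Matrix.diag, Matrix.mul_apply, Fin.sum_univ_three, Matrix.add_apply,
      Matrix.sub_apply, Matrix.smul_apply, smul_eq_mul, Matrix.zero_apply]
    fin_cases i <;> fin_cases j <;> simp <;> ring
  rw [h1, h2] at key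
  have : (1 / 6 * (0 ^ 3 - 3 * 0 * 0 + 2 * (q * q * q).trace) : ℂ) = (q * q * q).trace / 3 := by
    ring
  rw [this] at key
  simpa [sub_eq_zero] using key

/-- The spectral projector `P = (1 + q/x + q²/x²)/3` has trace 1, so some `P k k` is non-zero.
Column `k` is an eigenvector, and since `P` is symmetric and idempotent its square is `P k k`: it is
not null and can be rescaled. -/
theorem exists_unit_eigenvector {q : Matrix (Fin 3) (Fin 3) ℂ} (hs : q.IsSymm) (h1 : q.trace = 0)
    (h2 : (q * q).trace = 0) {x : ℂ} (hx : x ≠ 0) (h3 : q * q * q = (x ^ 3) • 1) :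
    ∃ u : Fin 3 → ℂ, q.mulVec u = x • u ∧ u ⬝ᵥ u = 1 / 2 := by
  set P : Matrix (Fin 3) (Fin 3) ℂ := (1 / 3 : ℂ) • (1 + x⁻¹ • q + (x⁻¹ ^ 2) • (q * q)) with hP
  have hqP : q * P = x • P := by
    simp only [hP, Matrix.mul_smul, Matrix.mul_add, Matrix.mul_one, ← mul_assoc, h3, smul_add,
      smul_smul]
    rw [show x * (1 / 3) * x⁻¹ = 1 / 3 by field_simp,
      show x * (1 / 3) * x⁻¹ ^ 2 = 1 / 3 * x⁻¹ by field_simp,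
      show 1 / 3 * x⁻¹ ^ 2 * x ^ 3 = x * (1 / 3) by field_simp]
    abel
  have hPP : P * P = P := by
    nth_rw 1 [hP]
    simp only [Matrix.smul_mul, Matrix.add_mul, Matrix.one_mul, mul_assoc, hqP, Matrix.mul_smul,
      smul_smul]
    rw [show x⁻¹ * x = 1 by field_simp, show x⁻¹ ^ 2 * (x * x) = 1 by field_simp]
    module
  have hPs : P.IsSymm := by
    have : (q * q).IsSymm := by
      rw [Matrix.IsSymm, Matrix.transpose_mul, hs.eq]
    rw [hP]
    exact ((Matrix.isSymm_one.add (hs.smul _)).add (this.smul _)).smul _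
  have htr : P.trace = 1 := by
    simp [hP, Matrix.trace_smul, Matrix.trace_add, h1, h2]
  obtain ⟨k, hk⟩ : ∃ k, P k k ≠ 0 := by
    by_contra! h
    simp [Matrix.trace, h] at htr
  obtain ⟨c, hc⟩ := IsAlgClosed.exists_pow_nat_eq (1 / 2 / P k k) (n := 2) (by norm_num)
  refine ⟨fun i => c * P i k, ?_, ?_⟩
  · funext i
    have := congrFun (congrFun hqP i) k
    simp only [Matrix.mul_apply, Matrix.smul_apply, smul_eq_mul] at this
    simp only [Matrix.mulVec, dotProduct, Pi.smul_apply, smul_eq_mul]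
    calc ∑ j, q i j * (c * P j k) = c * ∑ j, q i j * P j k := by
          rw [Finset.mul_sum]; exact Finset.sum_congr rfl fun j _ => by ring
      _ = _ := by rw [this]; ring
  · have := congrFun (congrFun hPP k) k
    simp only [Matrix.mul_apply] at this
    simp only [dotProduct]
    calc ∑ i, c * P i k * (c * P i k) = c ^ 2 * ∑ i, P k i * P i k := by
          rw [Finset.mul_sum]
          exact Finset.sum_congr rfl fun j _ => by rw [hPs.apply k j]; ring
      _ = _ := by rw [this, hc]; field_simp

/-- The self-dual part of `W` is diagonal, with components `m`, in the orthonormal frame of the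
bivectors `sd (u i)`. -/
structure IsFrame (W : Tens4 ℝ) (u : Fin 3 → Fin 3 → ℂ) (m : Fin 3 → ℂ) : Prop where
  -- `sdMetric` is `-2` times the dot product, so norm `-1` for bivectors means `1 / 2` here.
  orth : ∀ i j, u i ⬝ᵥ u j = if i = j then 1 / 2 else 0
  sum_eq_zero : ∑ i, m i = 0
  dec : selfDualPart (toComplex W) = dyad (fun i k => m i * u i k) u

theorem sum_outer_of_orth {u : Fin 3 → Fin 3 → ℂ}
    (h : ∀ i j, u i ⬝ᵥ u j = if i = j then 1 / 2 else 0) (k l : Fin 3) :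
    ∑ i, u i k * u i l = if k = l then 1 / 2 else 0 := by
  set M : Matrix (Fin 3) (Fin 3) ℂ := Matrix.of u
  have h1 : M * ((2 : ℂ) • M.transpose) = 1 := by
    ext i j
    have := h i j
    simp only [dotProduct] at this
    rw [Matrix.mul_smul]
    simp only [Matrix.smul_apply, Matrix.mul_apply, Matrix.transpose_apply, M,
      Matrix.of_apply, this, Matrix.one_apply, smul_eq_mul]
    split_ifs <;> norm_num
  have h2 := mul_eq_one_comm.mp h1
  have h3 := congrFun (congrFun h2 k) l
  rw [Matrix.smul_mul] at h3
  simp only [Matrix.smul_apply, Matrix.mul_apply, Matrix.transpose_apply, M,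
      Matrix.of_apply, Matrix.one_apply, smul_eq_mul] at h3
  split_ifs at h3 ⊢
  · linear_combination (1 / 2) * h3
  · linear_combination (1 / 2) * h3

theorem eq_sum_outer {q : Matrix (Fin 3) (Fin 3) ℂ} {u : Fin 3 → Fin 3 → ℂ} {m : Fin 3 → ℂ}
    (h : ∀ i j, u i ⬝ᵥ u j = if i = j then 1 / 2 else 0)
    (hq : ∀ i, q.mulVec (u i) = (m i / 2) • u i) (k l : Fin 3) :
    q k l = ∑ i, m i * u i k * u i l := by
  have h1 := sum_outer_of_orth h
  have h2 : q k l = 2 * ∑ j, q k j * ∑ i, u i j * u i l := by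
    simp [h1]
    ring
  rw [h2]
  simp only [Finset.mul_sum]
  rw [Finset.sum_comm]
  refine Finset.sum_congr rfl fun i _ => ?_
  have h3 := congrFun (hq i) k
  simp only [Matrix.mulVec, dotProduct, Pi.smul_apply, smul_eq_mul] at h3
  calc ∑ j, 2 * (q k j * (u i j * u i l)) = 2 * (∑ j, q k j * u i j) * u i l := by
        rw [Finset.mul_sum, Finset.sum_mul]
        exact Finset.sum_congr rfl fun j _ => by ring
    _ = _ := by rw [h3]; ring

theorem dyad_outer (u : Fin 3 → Fin 3 → ℂ) (m : Fin 3 → ℂ) :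
    dyad stdVec (fun k l => ∑ i, m i * u i k * u i l) = dyad (fun i k => m i * u i k) u := by
  funext a b c d
  simp only [dyad, sd_sum]
  simp only [Finset.mul_sum]
  rw [Finset.sum_comm]
  refine Finset.sum_congr rfl fun i _ => ?_
  rw [sd_eq_sum (fun k => m i * u i k), Finset.sum_mul]
  exact Finset.sum_congr rfl fun j _ => by ring

theorem isFrame_of_eigenvectors {W : Tens4 ℝ} {q : Matrix (Fin 3) (Fin 3) ℂ}
    (hq : q.trace = 0) (hW : selfDualPart (toComplex W) = dyad stdVec q)
    {u : Fin 3 → Fin 3 → ℂ} {m : Fin 3 → ℂ}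
    (h : ∀ i j, u i ⬝ᵥ u j = if i = j then 1 / 2 else 0)
    (hu : ∀ i, q.mulVec (u i) = (m i / 2) • u i) : IsFrame W u m := by
  have e := eq_sum_outer h hu
  refine ⟨h, ?_, ?_⟩
  · simp only [Matrix.trace, Matrix.diag, e] at hq
    rw [Finset.sum_comm] at hq
    have : ∀ i, ∑ k, m i * u i k * u i k = m i * (1 / 2) := fun i => by
      have := h i i
      simp only [dotProduct, if_true] at this
      rw [← this, Finset.mul_sum]
      exact Finset.sum_congr rfl fun j _ => by ring
    simp only [this, ← Finset.sum_mul] at hq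
    linear_combination 2 * hq
  · rw [hW, ← dyad_outer]
    congr 1
    funext k l
    exact e k l

theorem sdApply_dyad {ι : Type} [Fintype ι] (F G : ι → Fin 3 → ℂ) (f : Fin 3 → ℂ) (a b : Fin 4) :
    sdApply (dyad F G) (sd f) a b = ∑ i, (-2 * G i ⬝ᵥ f) * sd (F i) a b := by
  simp only [← sdMetric_sd, sdApply, sdMetric, dyad, Finset.mul_sum, Finset.sum_mul]
  calc _ = ∑ m, ∑ i, ∑ n, 1 / 2 * (sg ℂ m * sg ℂ n * (sd (F i) a b * sd (G i) m n) * sd f m n) :=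
        Finset.sum_congr rfl fun _ _ => Finset.sum_comm
    _ = ∑ i, ∑ m, ∑ n, 1 / 2 * (sg ℂ m * sg ℂ n * (sd (F i) a b * sd (G i) m n) * sd f m n) :=
        Finset.sum_comm
    _ = _ := Finset.sum_congr rfl fun _ _ => Finset.sum_congr rfl fun _ _ =>
        Finset.sum_congr rfl fun _ _ => by ring

theorem IsFrame.isEigenframe {W : Tens4 ℝ} {u : Fin 3 → Fin 3 → ℂ} {m : Fin 3 → ℂ}
    (h : IsFrame W u m) : IsEigenframe W fun i => sd (u i) := by
  refine ⟨fun i => isSDBivector_sd _, fun i j => ?_, fun i => ⟨-m i, fun a b => ?_⟩⟩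
  · rw [sdMetric_sd, h.orth]
    split_ifs <;> norm_num
  · rw [h.dec, sdApply_dyad]
    simp only [h.orth]
    rw [Finset.sum_eq_single i]
    · have := congrFun (congrFun (sdLin.map_smul (m i) (u i)) a) b
      change sd (m i • u i) a b = m i * sd (u i) a b at this
      change _ * sd (m i • u i) a b = _
      rw [this]
      simp
    · intro j _ hj
      simp [hj]
    · simp

theorem sd_injective : Function.Injective sd := by
  intro f g h
  funext k
  have := congrFun (congrFun h 0) k.succ
  fin_cases k <;> simpa [sd] using this

/-- Passing to electric parts makes the formula for `H` available for an arbitrary eigenframe, not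
only the constructed one. The sign `m = -ρ` comes from the factor `-2` in `sdApply_dyad`. -/
theorem exists_isFrame_of_isEigenframe {W : Tens4 ℝ} (hW : IsWeyl W) {U : Fin 3 → Tens2 ℂ}
    (hU : IsEigenframe W U) : ∃ u m, IsFrame W u m ∧ ∀ i, U i = sd (u i) := by
  obtain ⟨q, hs, ht, hq⟩ := hW.exists_matrix
  choose ρ hρ using hU.eigen
  have e : ∀ i, U i = sd fun k => U i 0 k.succ := fun i => (hU.sd i).eq_sd
  set u : Fin 3 → Fin 3 → ℂ := fun i k => U i 0 k.succ with hu
  refine ⟨u, fun i => -ρ i, isFrame_of_eigenvectors ht hq (fun i j => ?_) (fun i => ?_), e⟩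
  · have := hU.orthonormal i j
    rw [e i, e j, sdMetric_sd] at this
    split_ifs at this ⊢
    · linear_combination (-1 / 2) * this
    · linear_combination (-1 / 2) * this
  · have h1 : sd (fun k => ∑ i', (-2 * q i' ⬝ᵥ u i) * stdVec i' k) = sd (fun k => ρ i * u i k) := by
      funext a b
      have := hρ i a b
      rw [e i, hq] at this
      rw [sd_sum]
      refine ((sdApply_dyad stdVec (fun j => q j) (u i) a b).symm.trans this).trans ?_
      have := congrFun (congrFun (sdLin.map_smul (ρ i) (u i)) a) b
      exact this.symm
    have h2 := sd_injective h1
    rw [sum_mul_stdVec] at h2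
    funext k
    have := congrFun h2 k
    simp only [Matrix.mulVec, Pi.smul_apply, smul_eq_mul]
    linear_combination (-1 / 2) * this

/-- Since `q³` is a non-zero scalar `x³`, each of the three distinct numbers `x ζ^i` is an
eigenvalue; eigenvectors of a symmetric matrix for distinct eigenvalues are orthogonal. -/
theorem IsWeyl.exists_isFrame {W : Tens4 ℝ} (hW : IsWeyl W)
    (h2 : Tr (comp (belRobinson W) (belRobinson W)) = 0)
    (h3 : Tr (comp (comp (belRobinson W) (belRobinson W)) (belRobinson W)) ≠ 0) :
    ∃ u m, IsFrame W u m := by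
  obtain ⟨q, hs, ht, hq⟩ := hW.exists_matrix
  obtain ⟨e2, e3⟩ := Tr_belRobinson_of_dyad hq
  have t2 : (q * q).trace = 0 := by
    rw [h2] at e2
    simpa using e2.symm
  have t3 : (q * q * q).trace ≠ 0 := by
    intro h
    rw [h] at e3
    simp at e3
    exact h3 e3
  have hc := cube_eq_of_traces ht t2
  obtain ⟨x, hx⟩ := IsAlgClosed.exists_pow_nat_eq ((q * q * q).trace / 3) (n := 3) (by norm_num)
  have hx0 : x ≠ 0 := by
    rintro rfl
    apply t3
    linear_combination -3 * hx
  have hζ := Complex.isPrimitiveRoot_exp 3 (by norm_num)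
  set ζ := Complex.exp (2 * Real.pi * I / (3 : ℕ))
  have hζ0 : ζ ≠ 0 := hζ.ne_zero (by norm_num)
  have ex : ∀ i : Fin 3, ∃ u : Fin 3 → ℂ, q.mulVec u = (x * ζ ^ (i : ℕ)) • u ∧
      u ⬝ᵥ u = 1 / 2 := fun i => by
    apply exists_unit_eigenvector hs ht t2 (mul_ne_zero hx0 (pow_ne_zero _ hζ0))
    rw [hc, mul_pow, hx, ← pow_mul, mul_comm (i : ℕ), pow_mul, hζ.pow_eq_one, one_pow, mul_one]
  choose u hu1 hu2 using ex
  refine ⟨u, fun i => 2 * (x * ζ ^ (i : ℕ)),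
    isFrame_of_eigenvectors ht hq (fun i j => ?_) (fun i => ?_)⟩
  · split_ifs with h
    · rw [← h, hu2]
    · have h1 : q.mulVec (u i) ⬝ᵥ u j = u i ⬝ᵥ q.mulVec (u j) := by
        rw [Matrix.dotProduct_mulVec, ← Matrix.mulVec_transpose, hs.eq]
      rw [hu1, hu1, smul_dotProduct, dotProduct_smul, smul_eq_mul, smul_eq_mul] at h1
      have h2 : x * (ζ ^ (i : ℕ) - ζ ^ (j : ℕ)) * (u i ⬝ᵥ u j) = 0 := by linear_combination h1
      rcases mul_eq_zero.mp h2 with h3 | h3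
      · rcases mul_eq_zero.mp h3 with h4 | h4
        · exact absurd h4 hx0
        · exact absurd (Fin.ext (hζ.pow_inj i.2 j.2 (sub_eq_zero.mp h4))) h
      · exact h3
  · rw [hu1]
    congr 1
    ring

/-! ### The spectrum of `T` and the projector `A` -/

/-- The three components of a frame are the cube roots of a non-zero number. -/
structure IsCubeTriple (m : Fin 3 → ℂ) : Prop where
  ne_zero : ∀ i, m i ≠ 0
  cube : ∀ i j, m i ^ 3 = m j ^ 3
  inj : Function.Injective m

/-- The first two power sums kill the lower elementary symmetric functions, so the numbers are the
roots of `X³ = c`; the third keeps `c` non-zero and the roots distinct. -/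
theorem isCubeTriple_of_power_sums {m : Fin 3 → ℂ} (h1 : ∑ i, m i = 0) (h2 : ∑ i, m i ^ 2 = 0)
    (h3 : ∑ i, m i ^ 3 ≠ 0) : IsCubeTriple m := by
  simp only [Fin.sum_univ_three] at h1 h2 h3
  have e2 : m 2 = -(m 0 + m 1) := by linear_combination h1
  have e3 : m 0 ^ 2 + m 0 * m 1 + m 1 ^ 2 = 0 := by
    rw [e2] at h2
    linear_combination h2 / 2
  have c1 : m 1 ^ 3 = m 0 ^ 3 := by linear_combination (m 1 - m 0) * e3
  have c2 : m 2 ^ 3 = m 0 ^ 3 := by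
    rw [e2]; linear_combination (-2 * m 0 - m 1) * e3
  have hn : m 0 ^ 3 ≠ 0 := by
    intro h
    rw [c2, c1, h] at h3
    simp at h3
  have c : ∀ i, m i ^ 3 = m 0 ^ 3 := fun i => by fin_cases i <;> simp [c1, c2]
  have hn0 : ∀ i, m i ≠ 0 := fun i h => by
    apply hn
    rw [← c i, h]
    simp
  have d01 : m 0 ≠ m 1 := fun h => by
    rw [← h] at e3
    apply hn0 0
    have : m 0 ^ 2 = 0 := by linear_combination e3 / 3
    simpa using this
  have d02 : m 0 ≠ m 2 := fun h => by
    have h4 : m 1 = -2 * m 0 := by linear_combination h1 + h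
    rw [h4] at e3
    apply hn0 0
    have : m 0 ^ 2 = 0 := by linear_combination e3 / 3
    simpa using this
  have d12 : m 1 ≠ m 2 := fun h => by
    have h4 : m 0 = -2 * m 1 := by linear_combination h1 + h
    rw [h4] at e3
    apply hn0 1
    have : m 1 ^ 2 = 0 := by linear_combination e3 / 3
    simpa using this
  refine ⟨hn0, fun i j => by rw [c i, c j], ?_⟩
  intro i j h
  fin_cases i <;> fin_cases j <;> first | rfl | exfalso; simp at h
  · exact d01 h
  · exact d02 h
  · exact d01 h.symm
  · exact d12 h
  · exact d02 h.symm
  · exact d12 h.symm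

theorem mixed_smul (x y : ℂ) (f h : Fin 3 → ℂ) (a b : Fin 4) :
    mixed (fun k => x * f k) (fun k => y * h k) a b = x * y * mixed f h a b := by
  rw [mixed_values, mixed_values]
  fin_cases a <;> fin_cases b <;> simp <;> ring

/-- The products of the bivectors of a frame with the conjugate ones. -/
noncomputable def frameMixed (u : Fin 3 → Fin 3 → ℂ) (k : Fin 3 × Fin 3) : Tens2 ℂ :=
  mixed (u k.1) fun i => conj (u k.2 i)

/-- The norms `1/2` of the two factors cancel the 4 of `contr_mixed`. The nine products thus
diagonalise `T` orthonormally for the bilinear contraction. -/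
theorem contrC_frameMixed {u : Fin 3 → Fin 3 → ℂ}
    (h : ∀ i j, u i ⬝ᵥ u j = if i = j then 1 / 2 else 0) (k l : Fin 3 × Fin 3) :
    contrC (frameMixed u k) (frameMixed u l) = if k = l then 1 else 0 := by
  have hc : ∀ i j, (fun k => conj (u i k)) ⬝ᵥ (fun k => conj (u j k)) =
      if i = j then 1 / 2 else 0 := fun i j => by
    have := congrArg conj (h i j)
    simp only [dotProduct, map_sum, map_mul] at this ⊢
    rw [this]
    split_ifs <;> simp [map_ofNat]
  rw [contrC, frameMixed, frameMixed, contr_mixed, h, hc]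
  simp only [Prod.ext_iff]
  split_ifs <;> simp_all
  norm_num

theorem contrC_smul (x : ℂ) (P Q : Tens2 ℂ) :
    contrC (fun a b => x * P a b) Q = x * contrC P Q := by
  simp only [contrC, Finset.mul_sum]
  exact Finset.sum_congr rfl fun _ _ => Finset.sum_congr rfl fun _ _ => by ring

theorem comp_of_diag {κ : Type} [Fintype κ] [DecidableEq κ] {T R : Tens4 ℝ} {P : κ → Tens2 ℂ}
    {x y : κ → ℂ} (hP : ∀ k l, contrC (P k) (P l) = if k = l then 1 else 0)
    (hT : ∀ a b c d, (T a b c d : ℂ) = ∑ k, P k a b * (x k * P k c d))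
    (hR : ∀ a b c d, (R a b c d : ℂ) = ∑ k, P k a b * (y k * P k c d)) (a b c d : Fin 4) :
    (comp T R a b c d : ℂ) = ∑ k, P k a b * (x k * y k * P k c d) := by
  rw [comp_of_sum (Q := fun k c d => x k * P k c d) (Q' := fun k c d => y k * P k c d) hT hR]
  simp [contrC_smul, hP, mul_assoc]

theorem Tr_of_diag {κ : Type} [Fintype κ] [DecidableEq κ] {T : Tens4 ℝ} {P : κ → Tens2 ℂ}
    {x : κ → ℂ} (hP : ∀ k l, contrC (P k) (P l) = if k = l then 1 else 0)
    (hT : ∀ a b c d, (T a b c d : ℂ) = ∑ k, P k a b * (x k * P k c d)) :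
    (Tr T : ℂ) = ∑ k, x k := by
  rw [Tr_of_sum (Q := fun k c d => x k * P k c d) hT]
  simp [contrC_smul, hP]

theorem IsFrame.belRobinson_eq {W : Tens4 ℝ} {u : Fin 3 → Fin 3 → ℂ} {m : Fin 3 → ℂ}
    (h : IsFrame W u m) (a b c d : Fin 4) :
    (belRobinson W a b c d : ℂ) = ∑ k : Fin 3 × Fin 3, frameMixed u k a b *
      (m k.1 * conj (m k.2) * frameMixed u k c d) := by
  rw [belRobinson_of_dyad h.dec, Fintype.sum_prod_type]
  refine Finset.sum_congr rfl fun i _ => Finset.sum_congr rfl fun j _ => ?_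
  simp only [map_mul, mixed_smul, frameMixed]
  ring

/-- The data of a Bel-Robinson tensor of the type considered. -/
structure IsCubeType (T : Tens4 ℝ) (t : ℝ) : Prop where
  tr_sq : Tr (comp T T) = 0
  tr_cube : 9 * t ^ 3 = Tr (comp (comp T T) T)
  ne_zero : Tr (comp (comp T T) T) ≠ 0

/-- The eigenvalues of `T` are `m i * conj (m j)`, so `Tr T^k` is the squared modulus of the `k`-th
power sum. For `k = 3` this is `9 |m i|^6`, and real cube roots are unique, so `|m i|² = t`. -/
theorem IsFrame.spectrum {W : Tens4 ℝ} {u : Fin 3 → Fin 3 → ℂ} {m : Fin 3 → ℂ}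
    (h : IsFrame W u m) {t : ℝ} (ht : IsCubeType (belRobinson W) t) :
    IsCubeTriple m ∧ (∀ i, m i * conj (m i) = t) ∧ 0 < t := by
  have hP := contrC_frameMixed h.orth
  have c1 := h.belRobinson_eq
  have c2 := comp_of_diag hP c1 c1
  have c3 := comp_of_diag hP c2 c1
  have t2 := Tr_of_diag hP c2
  have t3 := Tr_of_diag hP c3
  have e2 : ((Tr (comp (belRobinson W) (belRobinson W)) : ℝ) : ℂ)
      = (∑ i, m i ^ 2) * conj (∑ i, m i ^ 2) := by
    rw [t2, Fintype.sum_prod_type, map_sum, Finset.sum_mul_sum]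
    exact Finset.sum_congr rfl fun _ _ => Finset.sum_congr rfl fun _ _ => by
      rw [map_pow]; ring
  have e3 : ((Tr (comp (comp (belRobinson W) (belRobinson W)) (belRobinson W)) : ℝ) : ℂ)
      = (∑ i, m i ^ 3) * conj (∑ i, m i ^ 3) := by
    rw [t3, Fintype.sum_prod_type, map_sum, Finset.sum_mul_sum]
    exact Finset.sum_congr rfl fun _ _ => Finset.sum_congr rfl fun _ _ => by
      rw [map_pow]; ring
  have hm : IsCubeTriple m := by
    apply isCubeTriple_of_power_sums h.sum_eq_zero
    · rw [ht.tr_sq] at e2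
      rw [Complex.mul_conj, Complex.ofReal_zero, eq_comm, Complex.ofReal_eq_zero,
        Complex.normSq_eq_zero] at e2
      exact e2
    · intro h0
      rw [h0] at e3
      simp only [zero_mul, Complex.ofReal_eq_zero] at e3
      exact ht.ne_zero e3
  have hn : ∀ i, Complex.normSq (m i) = t := fun i => by
    have s : ∑ j, m j ^ 3 = 3 * m i ^ 3 := by
      simp only [hm.cube _ i]
      simp
    rw [s, ← ht.tr_cube, Complex.mul_conj] at e3
    have e4 : 9 * t ^ 3 = Complex.normSq (3 * m i ^ 3) := by exact_mod_cast e3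
    rw [map_mul, map_pow, Complex.normSq_ofNat] at e4
    have e5 : Complex.normSq (m i) ^ 3 = t ^ 3 := by linarith
    exact (Odd.strictMono_pow (by decide : Odd 3)).injective e5
  refine ⟨hm, fun i => ?_, ?_⟩
  · rw [Complex.mul_conj, hn]
  · rw [← hn 0, Complex.normSq_pos]
    exact hm.ne_zero 0

/-- The real eigentensors of a frame. -/
noncomputable def frameProj (u : Fin 3 → Fin 3 → ℂ) (i : Fin 3) : Tens2 ℝ :=
  fun a b => (frameMixed u (i, i) a b).re

theorem ofReal_frameProj (u : Fin 3 → Fin 3 → ℂ) (i : Fin 3) (a b : Fin 4) :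
    (frameProj u i a b : ℂ) = frameMixed u (i, i) a b := by
  rw [frameProj, ← Complex.conj_eq_iff_re, frameMixed, conj_mixed]
  simp

theorem IsCubeTriple.sum_powers {m : Fin 3 → ℂ} (hm : IsCubeTriple m) (i j : Fin 3) :
    m i / m j + (m i / m j) ^ 2 + (m i / m j) ^ 3 = if i = j then 3 else 0 := by
  have h0 := hm.ne_zero j
  split_ifs with h
  · rw [h, div_self h0]; norm_num
  · have h1 : (m i / m j) ^ 3 = 1 := by
      rw [div_pow, hm.cube i j, div_self (pow_ne_zero _ h0)]
    have h2 : m i / m j - 1 ≠ 0 := by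
      intro h3
      rw [sub_eq_zero, div_eq_one_iff_eq h0] at h3
      exact h (hm.inj h3)
    apply mul_left_cancel₀ h2
    linear_combination (m i / m j) * h1

/-- On the product `(i, j)` the eigenvalue of `T/t` is `z = m i / m j`, a cube root of unity, and
`(z + z² + z³)/3` is 1 for `i = j` and 0 otherwise. -/
theorem IsFrame.concA_eq {W : Tens4 ℝ} {u : Fin 3 → Fin 3 → ℂ} {m : Fin 3 → ℂ}
    (h : IsFrame W u m) {t : ℝ} (ht : IsCubeType (belRobinson W) t) (a b c d : Fin 4) :
    concA (belRobinson W) t a b c d = ∑ i, frameProj u i a b * frameProj u i c d := by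
  obtain ⟨hm, hn, hpos⟩ := h.spectrum ht
  have hP := contrC_frameMixed h.orth
  have c1 := h.belRobinson_eq
  have c2 := comp_of_diag hP c1 c1
  have c3 := comp_of_diag hP c2 c1
  have ht0 : (t : ℂ) ≠ 0 := by exact_mod_cast hpos.ne'
  have e : (concA (belRobinson W) t a b c d : ℂ) =
      ∑ i, (frameProj u i a b : ℂ) * frameProj u i c d := by
    simp only [concA]
    push_cast
    rw [c1, c2, c3, Finset.sum_div, Finset.sum_div, Finset.sum_div, ← Finset.sum_add_distrib,
      ← Finset.sum_add_distrib, Finset.mul_sum, Fintype.sum_prod_type]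
    refine Finset.sum_congr rfl fun i _ => ?_
    rw [Finset.sum_eq_single i]
    · have := hn i
      simp only [ofReal_frameProj, this]
      field_simp
      ring
    · intro j _ hj
      have h0 := hm.ne_zero j
      have h2 := hm.sum_powers i j
      rw [if_neg (Ne.symm hj)] at h2
      have h3 : conj (m j) = t / m j := by
        rw [← hn j]; field_simp
      simp only [h3]
      generalize frameMixed u (i, j) a b = x
      generalize frameMixed u (i, j) c d = y
      have h4 : m i * (t / m j) = t * (m i / m j) := by ring
      rw [h4]
      generalize m i / m j = z at h2
      field_simp
      linear_combination x * y * h2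
    · simp
  exact_mod_cast e

/-! ### The multiplication table of the eigentensors -/

theorem eq_sum_of_orth {u : Fin 3 → Fin 3 → ℂ}
    (h : ∀ i j, u i ⬝ᵥ u j = if i = j then 1 / 2 else 0) (v : Fin 3 → ℂ) :
    v = fun k => ∑ i, 2 * (v ⬝ᵥ u i) * u i k := by
  funext k
  have h1 := sum_outer_of_orth h
  simp only [Fin.sum_univ_three, dotProduct] at h1 ⊢
  have e0 := h1 0 k
  have e1 := h1 1 k
  have e2 := h1 2 k
  have : v k = v 0 * (if 0 = k then 1 else 0) + v 1 * (if 1 = k then 1 else 0)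
      + v 2 * (if 2 = k then 1 else 0) := by
    fin_cases k <;> simp
  rw [this]
  have r : ∀ (j : Fin 3), (if j = k then (1 : ℂ) else 0) = 2 * if j = k then 1 / 2 else 0 :=
    fun j => by split_ifs <;> norm_num
  rw [r, r, r]
  linear_combination -2 * v 0 * e0 - 2 * v 1 * e1 - 2 * v 2 * e2

/-- The cross product is orthogonal to both factors, hence a multiple `x` of the third vector.
Lagrange's identity gives `x² = 1/2`; the sign depends on the orientation, but only `x * conj x`
enters the products of eigentensors. -/
theorem cross_of_orth {u : Fin 3 → Fin 3 → ℂ}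
    (h : ∀ i j, u i ⬝ᵥ u j = if i = j then 1 / 2 else 0) {i j k : Fin 3} (hij : i ≠ j)
    (hjk : j ≠ k) (hik : i ≠ k) :
    ∃ x : ℂ, x * conj x = 1 / 2 ∧ crossProduct (u i) (u j) = fun l => x * u k l := by
  set v := crossProduct (u i) (u j) with hv
  have h1 := eq_sum_of_orth h v
  have hi : v ⬝ᵥ u i = 0 := by rw [dotProduct_comm]; exact dot_self_cross _ _
  have hj : v ⬝ᵥ u j = 0 := by rw [dotProduct_comm]; exact dot_cross_self _ _
  have h2 : v = fun l => 2 * (v ⬝ᵥ u k) * u k l := by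
    conv_lhs => rw [h1]
    funext l
    rw [Finset.sum_eq_single k]
    · intro b _ hb
      have key : ∀ i j k b : Fin 3, i ≠ j → j ≠ k → i ≠ k → b ≠ k → b = i ∨ b = j := by decide
      rcases key i j k b hij hjk hik hb with rfl | rfl
      · rw [hi]; ring
      · rw [hj]; ring
    · simp
  refine ⟨2 * (v ⬝ᵥ u k), ?_, h2⟩
  have h3 : v ⬝ᵥ v = 1 / 4 := by
    rw [hv, cross_dot_cross, h, h, h, h]
    simp [hij, hij.symm]
    norm_num
  have h4 : v ⬝ᵥ v = (2 * (v ⬝ᵥ u k)) ^ 2 * (u k ⬝ᵥ u k) := by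
    conv_lhs => rw [h2]
    simp only [dotProduct, Fin.sum_univ_three]
    ring
  rw [h3, h, if_pos rfl] at h4
  generalize 2 * (v ⬝ᵥ u k) = x at h4
  have h5 := congrArg Complex.normSq (show x ^ 2 = 1 / 2 by linear_combination -2 * h4)
  rw [map_pow, map_div₀, map_one, Complex.normSq_ofNat] at h5
  have h6 : Complex.normSq x = 1 / 2 := by
    have := Complex.normSq_nonneg x
    nlinarith
  rw [Complex.mul_conj, h6]
  norm_num

/-- The multiplication table of the eigentensors of an orthonormal frame. -/
structure IsProjSystem (p : Fin 3 → Tens2 ℝ) : Prop where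
  symm : ∀ i a b, p i a b = p i b a
  sq : ∀ i a b, ∑ e, sg ℝ e * (p i a e * p i b e) = 1 / 4 * metric ℝ a b
  mul : ∀ i j k, i ≠ j → j ≠ k → i ≠ k → ∀ a b,
    ∑ e, sg ℝ e * (p i a e * p j b e) = 1 / 2 * p k a b
  contr_eq : ∀ i j, contr (p i) (p j) = if i = j then 1 else 0

theorem ofReal_metric (a b : Fin 4) : ((metric ℝ a b : ℝ) : ℂ) = metric ℂ a b := by
  unfold metric
  split_ifs <;> simp [ofReal_sg]

theorem isProjSystem_frameProj {u : Fin 3 → Fin 3 → ℂ}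
    (h : ∀ i j, u i ⬝ᵥ u j = if i = j then 1 / 2 else 0) : IsProjSystem (frameProj u) := by
  have hc : ∀ i j, (fun k => conj (u i k)) ⬝ᵥ (fun k => conj (u j k)) =
      if i = j then 1 / 2 else 0 := fun i j => by
    have := congrArg conj (h i j)
    simp only [dotProduct, map_sum, map_mul] at this ⊢
    rw [this]
    split_ifs <;> simp [map_ofNat]
  refine ⟨fun i a b => ?_, fun i a b => ?_, fun i j k hij hjk hik a b => ?_, fun i j => ?_⟩
  · simp only [frameProj, frameMixed, mixed_symm _ _ a b]
  · have e : ((∑ e, sg ℝ e * (frameProj u i a e * frameProj u i b e) : ℝ) : ℂ)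
        = (1 / 4 * metric ℝ a b : ℝ) := by
      push_cast
      simp only [ofReal_frameProj, ofReal_sg, ofReal_metric, frameMixed, ← mul_assoc]
      rw [mixed_mul_mixed_self, h, hc]
      norm_num
    exact_mod_cast e
  · have e : ((∑ e, sg ℝ e * (frameProj u i a e * frameProj u j b e) : ℝ) : ℂ)
        = (1 / 2 * frameProj u k a b : ℝ) := by
      push_cast
      simp only [ofReal_frameProj, ofReal_sg, frameMixed, ← mul_assoc]
      -- For `i ≠ j` both dot products vanish and only the product of the two cross products
      -- survives.
      rw [mixed_mul_mixed, h, hc, if_neg hij]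
      obtain ⟨x, hx, hv⟩ := cross_of_orth h hij hjk hik
      have hv' : crossProduct (fun l => conj (u i l)) (fun l => conj (u j l))
          = fun l => conj x * conj (u k l) := by
        funext l
        have := congrArg conj (congrFun hv l)
        rw [map_mul] at this
        rw [← this]
        simp only [cross_apply]
        fin_cases l <;> simp
      rw [hv, hv', mixed_smul, hx]
      ring
    exact_mod_cast e
  · have e : ((contr (frameProj u i) (frameProj u j) : ℝ) : ℂ)
        = contrC (frameMixed u (i, i)) (frameMixed u (j, j)) := by
      simp only [contr, contrC, up]
      push_cast
      simp only [ofReal_frameProj, ofReal_sg]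
      exact Finset.sum_congr rfl fun _ _ => Finset.sum_congr rfl fun _ _ => by ring
    rw [contrC_frameMixed h] at e
    simp only [Prod.mk.injEq, and_self] at e
    split_ifs at e ⊢ <;> exact_mod_cast e

/-! ### The concomitants `B`, `C` and their contractions with `X` -/

/-- The sum of the squares of the eigentensors. -/
noncomputable def projSum (p : Fin 3 → Tens2 ℝ) : Tens4 ℝ :=
  fun a b c d => ∑ i, p i a b * p i c d

section

variable {p : Fin 3 → Tens2 ℝ}

/-- The subtracted metric term cancels exactly the products of an eigentensor with itself, leaving
the full symmetrisation of `p 0 ⊗ p 1 ⊗ p 2`. -/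
theorem IsProjSystem.concB_eq (h : IsProjSystem p) (a b c d l m : Fin 4) :
    concB (projSum p) a b c d l m =
      (p 1 a b * p 2 c d + p 2 a b * p 1 c d) * p 0 l m
      + (p 0 a b * p 2 c d + p 2 a b * p 0 c d) * p 1 l m
      + (p 0 a b * p 1 c d + p 1 a b * p 0 c d) * p 2 l m := by
  have s0 := h.sq 0 l m
  have s1 := h.sq 1 l m
  have s2 := h.sq 2 l m
  have m01 := h.mul 0 1 2 (by decide) (by decide) (by decide) l m
  have m02 := h.mul 0 2 1 (by decide) (by decide) (by decide) l m
  have m10 := h.mul 1 0 2 (by decide) (by decide) (by decide) l m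
  have m12 := h.mul 1 2 0 (by decide) (by decide) (by decide) l m
  have m20 := h.mul 2 0 1 (by decide) (by decide) (by decide) l m
  have m21 := h.mul 2 1 0 (by decide) (by decide) (by decide) l m
  simp only [concB, projSum, Fin.sum_univ_three]
  simp only [Fin.sum_univ_four] at *
  linear_combination 2 * p 0 a b * p 0 c d * s0 + 2 * p 1 a b * p 1 c d * s1
    + 2 * p 2 a b * p 2 c d * s2 + 2 * p 0 a b * p 1 c d * m01 + 2 * p 0 a b * p 2 c d * m02
    + 2 * p 1 a b * p 0 c d * m10 + 2 * p 1 a b * p 2 c d * m12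
    + 2 * p 2 a b * p 0 c d * m20 + 2 * p 2 a b * p 1 c d * m21

theorem IsProjSystem.concC_eq (h : IsProjSystem p) (a b c d l m n r : Fin 4) :
    concC (projSum p) a b c d l m n r =
      (p 1 c d * p 2 l m + p 2 c d * p 1 l m) * (p 1 a b * p 2 n r + p 2 a b * p 1 n r)
      + (p 0 c d * p 2 l m + p 2 c d * p 0 l m) * (p 0 a b * p 2 n r + p 2 a b * p 0 n r)
      + (p 0 c d * p 1 l m + p 1 c d * p 0 l m) * (p 0 a b * p 1 n r + p 1 a b * p 0 n r) := by
  have s0 := h.sq 0 n r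
  have s1 := h.sq 1 n r
  have s2 := h.sq 2 n r
  have m01 := h.mul 0 1 2 (by decide) (by decide) (by decide) n r
  have m02 := h.mul 0 2 1 (by decide) (by decide) (by decide) n r
  have m10 := h.mul 1 0 2 (by decide) (by decide) (by decide) n r
  have m12 := h.mul 1 2 0 (by decide) (by decide) (by decide) n r
  have m20 := h.mul 2 0 1 (by decide) (by decide) (by decide) n r
  have m21 := h.mul 2 1 0 (by decide) (by decide) (by decide) n r
  simp only [concC, h.concB_eq]
  simp only [projSum, Fin.sum_univ_three]
  simp only [Fin.sum_univ_four] at *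
  linear_combination 2 * p 0 a b * (p 1 c d * p 2 l m + p 2 c d * p 1 l m) * s0
    + 2 * p 0 a b * (p 0 c d * p 2 l m + p 2 c d * p 0 l m) * m01
    + 2 * p 0 a b * (p 0 c d * p 1 l m + p 1 c d * p 0 l m) * m02
    + 2 * p 1 a b * (p 1 c d * p 2 l m + p 2 c d * p 1 l m) * m10
    + 2 * p 1 a b * (p 0 c d * p 2 l m + p 2 c d * p 0 l m) * s1
    + 2 * p 1 a b * (p 0 c d * p 1 l m + p 1 c d * p 0 l m) * m12
    + 2 * p 2 a b * (p 1 c d * p 2 l m + p 2 c d * p 1 l m) * m20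
    + 2 * p 2 a b * (p 0 c d * p 2 l m + p 2 c d * p 0 l m) * m21
    + 2 * p 2 a b * (p 0 c d * p 1 l m + p 1 c d * p 0 l m) * s2

theorem sum_up_linear (p : Fin 3 → Tens2 ℝ) (X : Tens2 ℝ) (x0 x1 x2 : ℝ) :
    ∑ c, ∑ d, (x0 * p 0 c d + x1 * p 1 c d + x2 * p 2 c d) * up X c d =
      x0 * contr (p 0) X + x1 * contr (p 1) X + x2 * contr (p 2) X := by
  simp only [contr, Finset.mul_sum, ← Finset.sum_add_distrib]
  exact Finset.sum_congr rfl fun _ _ => Finset.sum_congr rfl fun _ _ => by ring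

theorem sum_up_linear' (p : Fin 3 → Tens2 ℝ) (X : Tens2 ℝ) {f : Tens2 ℝ} (x0 x1 x2 : ℝ)
    (hf : ∀ c d, f c d = x0 * p 0 c d + x1 * p 1 c d + x2 * p 2 c d) :
    ∑ c, ∑ d, f c d * up X c d =
      x0 * contr (p 0) X + x1 * contr (p 1) X + x2 * contr (p 2) X := by
  simp only [hf]
  exact sum_up_linear p X x0 x1 x2

theorem AX_eq (X : Tens2 ℝ) (a b : Fin 4) : AX (projSum p) X a b =
    contr (p 0) X * p 0 a b + contr (p 1) X * p 1 a b + contr (p 2) X * p 2 a b := by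
  rw [AX, sum_up_linear' p X (f := projSum p a b) (p 0 a b) (p 1 a b) (p 2 a b)]
  · ring
  · intro c d
    simp only [projSum, Fin.sum_univ_three]

theorem IsProjSystem.BX_eq (h : IsProjSystem p) (X : Tens2 ℝ) (a b c d : Fin 4) :
    BX (projSum p) X a b c d = contr (p 0) X * (p 1 a b * p 2 c d + p 2 a b * p 1 c d)
      + contr (p 1) X * (p 0 a b * p 2 c d + p 2 a b * p 0 c d)
      + contr (p 2) X * (p 0 a b * p 1 c d + p 1 a b * p 0 c d) := by
  rw [BX, sum_up_linear' p X (f := concB (projSum p) a b c d)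
    (p 1 a b * p 2 c d + p 2 a b * p 1 c d) (p 0 a b * p 2 c d + p 2 a b * p 0 c d)
    (p 0 a b * p 1 c d + p 1 a b * p 0 c d)]
  · ring
  · intro l m
    rw [h.concB_eq]

theorem IsProjSystem.BXX_eq (h : IsProjSystem p) (X : Tens2 ℝ) (a b : Fin 4) :
    BXX (projSum p) X a b = 2 * (contr (p 1) X * contr (p 2) X * p 0 a b
      + contr (p 0) X * contr (p 2) X * p 1 a b + contr (p 0) X * contr (p 1) X * p 2 a b) := by
  rw [BXX, sum_up_linear' p X (f := BX (projSum p) X a b)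
    (contr (p 1) X * p 2 a b + contr (p 2) X * p 1 a b)
    (contr (p 0) X * p 2 a b + contr (p 2) X * p 0 a b)
    (contr (p 0) X * p 1 a b + contr (p 1) X * p 0 a b)]
  · ring
  · intro c d
    rw [h.BX_eq]
    ring

theorem IsProjSystem.CXX_eq (h : IsProjSystem p) (X : Tens2 ℝ) (a b n r : Fin 4) :
    CXX (projSum p) X a b n r =
      2 * (contr (p 1) X * contr (p 2) X * (p 1 a b * p 2 n r + p 2 a b * p 1 n r)
      + contr (p 0) X * contr (p 2) X * (p 0 a b * p 2 n r + p 2 a b * p 0 n r)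
      + contr (p 0) X * contr (p 1) X * (p 0 a b * p 1 n r + p 1 a b * p 0 n r)) := by
  generalize e0 : p 1 a b * p 2 n r + p 2 a b * p 1 n r = c0
  generalize e1 : p 0 a b * p 2 n r + p 2 a b * p 0 n r = c1
  generalize e2 : p 0 a b * p 1 n r + p 1 a b * p 0 n r = c2
  have inner : ∀ c d, ∑ l, ∑ m, concC (projSum p) a b c d l m n r * up X c d * up X l m =
      ((c1 * contr (p 2) X + c2 * contr (p 1) X) * p 0 c d
      + (c0 * contr (p 2) X + c2 * contr (p 0) X) * p 1 c d
      + (c0 * contr (p 1) X + c1 * contr (p 0) X) * p 2 c d) * up X c d := by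
    intro c d
    rw [sum_up_linear' p X (f := fun l m => concC (projSum p) a b c d l m n r * up X c d)
      ((p 2 c d * c1 + p 1 c d * c2) * up X c d) ((p 2 c d * c0 + p 0 c d * c2) * up X c d)
      ((p 1 c d * c0 + p 0 c d * c1) * up X c d)]
    · ring
    · intro l m
      simp only [h.concC_eq, e0, e1, e2]
      ring
  rw [CXX]
  simp only [inner]
  rw [sum_up_linear]
  ring

/-- Together with the two formulas for `β` and `γ`, this makes `y³ - 3αy² + 3γy - β²` the cubic
whose roots are the squared components of `X`. -/
theorem scalAlpha_eq (X : Tens2 ℝ) : scalAlpha (projSum p) X =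
    (contr (p 0) X ^ 2 + contr (p 1) X ^ 2 + contr (p 2) X ^ 2) / 3 := by
  rw [scalAlpha, contr, sum_up_linear' p X _ _ _ (AX_eq X)]
  ring

theorem IsProjSystem.scalBeta_eq (h : IsProjSystem p) (X : Tens2 ℝ) : scalBeta (projSum p) X =
    contr (p 0) X * contr (p 1) X * contr (p 2) X := by
  rw [scalBeta, contr, sum_up_linear' p X (2 * (contr (p 1) X * contr (p 2) X))
    (2 * (contr (p 0) X * contr (p 2) X)) (2 * (contr (p 0) X * contr (p 1) X))]
  · ring
  · intro a b
    rw [h.BXX_eq]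
    ring

theorem IsProjSystem.scalGamma_eq (h : IsProjSystem p) (X : Tens2 ℝ) :
    scalGamma (projSum p) X = (contr (p 1) X ^ 2 * contr (p 2) X ^ 2
      + contr (p 0) X ^ 2 * contr (p 2) X ^ 2 + contr (p 0) X ^ 2 * contr (p 1) X ^ 2) / 3 := by
  have inner : ∀ a b, ∑ n, ∑ r, CXX (projSum p) X a b n r * up X n r =
      2 * (contr (p 0) X * (contr (p 1) X ^ 2 + contr (p 2) X ^ 2)) * p 0 a b
      + 2 * (contr (p 1) X * (contr (p 0) X ^ 2 + contr (p 2) X ^ 2)) * p 1 a b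
      + 2 * (contr (p 2) X * (contr (p 0) X ^ 2 + contr (p 1) X ^ 2)) * p 2 a b := by
    intro a b
    rw [sum_up_linear' p X (f := CXX (projSum p) X a b)
      (2 * (contr (p 0) X * contr (p 2) X * p 2 a b + contr (p 0) X * contr (p 1) X * p 1 a b))
      (2 * (contr (p 1) X * contr (p 2) X * p 2 a b + contr (p 0) X * contr (p 1) X * p 0 a b))
      (2 * (contr (p 1) X * contr (p 2) X * p 1 a b + contr (p 0) X * contr (p 2) X * p 0 a b))]
    · ring
    · intro n r
      rw [h.CXX_eq]
      ring
  rw [scalGamma, contr, sum_up_linear' p X _ _ _ inner]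
  ring

theorem IsProjSystem.tensE_eq (h : IsProjSystem p) (X : Tens2 ℝ) (a b c d : Fin 4) :
    tensE (projSum p) X a b c d = ∑ i, contr (p i) X ^ 2 * (p i a b * p i c d) := by
  rw [tensE, h.CXX_eq, AX_eq, AX_eq, Fin.sum_univ_three]
  ring

/-- The term `β B(X)` removes the off-diagonal products, just as `C(X,X)/2` does in `E`. -/
theorem IsProjSystem.tensI_eq (h : IsProjSystem p) (X : Tens2 ℝ) (a b c d : Fin 4) :
    tensI (projSum p) X a b c d = contr (p 1) X ^ 2 * contr (p 2) X ^ 2 * (p 0 a b * p 0 c d)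
      + contr (p 0) X ^ 2 * contr (p 2) X ^ 2 * (p 1 a b * p 1 c d)
      + contr (p 0) X ^ 2 * contr (p 1) X ^ 2 * (p 2 a b * p 2 c d) := by
  rw [tensI, h.BX_eq, h.BXX_eq, h.BXX_eq, h.scalBeta_eq]
  ring

end

/-! ### Triples of cube roots and their cyclic order -/

/-- The discriminant product `(m₀ - m₁)(m₁ - m₂)(m₂ - m₀)`. -/
def altProd (m : Fin 3 → ℂ) : ℂ := (m 0 - m 1) * (m 1 - m 2) * (m 2 - m 0)

theorem IsCubeTriple.quad {m : Fin 3 → ℂ} (h : IsCubeTriple m) {i j : Fin 3} (hij : i ≠ j) :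
    m i ^ 2 + m i * m j + m j ^ 2 = 0 := by
  have h1 : m i - m j ≠ 0 := sub_ne_zero.mpr fun e => hij (h.inj e)
  apply mul_left_cancel₀ h1
  linear_combination h.cube i j

theorem IsCubeTriple.sum_eq_zero {m : Fin 3 → ℂ} (h : IsCubeTriple m) : m 0 + m 1 + m 2 = 0 := by
  have h1 : m 1 - m 2 ≠ 0 := sub_ne_zero.mpr fun e => absurd (h.inj e) (by decide)
  apply mul_left_cancel₀ h1
  linear_combination h.quad (show (0 : Fin 3) ≠ 1 by decide) - h.quad (show (0 : Fin 3) ≠ 2 by decide)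

theorem IsCubeTriple.altProd_eq {m : Fin 3 → ℂ} (h : IsCubeTriple m) :
    altProd m = -3 * m 0 ^ 2 * (m 0 + 2 * m 1) := by
  have h1 := h.quad (show (0 : Fin 3) ≠ 1 by decide)
  have h2 : m 2 = -m 0 - m 1 := by linear_combination h.sum_eq_zero
  rw [altProd, h2]
  linear_combination (m 0 + 2 * m 1) * h1

theorem IsCubeTriple.altProd_sq {m : Fin 3 → ℂ} (h : IsCubeTriple m) :
    altProd m ^ 2 = -27 * (m 0 ^ 3) ^ 2 := by
  have h1 := h.quad (show (0 : Fin 3) ≠ 1 by decide)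
  rw [h.altProd_eq]
  linear_combination 36 * m 0 ^ 4 * h1

/-- The quotient equals `-3 (1 + 2 m 1 / m 0)`, so it fixes the ratio of the first two entries, and
the zero sum fixes the third. It takes only the values `±√-27`, one for each cyclic order. -/
theorem IsCubeTriple.exists_eq_mul {m n : Fin 3 → ℂ} (hm : IsCubeTriple m) (hn : IsCubeTriple n)
    (h : altProd m / m 0 ^ 3 = altProd n / n 0 ^ 3) : ∃ x : ℂ, ∀ i, n i = x * m i := by
  have m0 := hm.ne_zero 0
  have n0 := hn.ne_zero 0
  rw [hm.altProd_eq, hn.altProd_eq, div_eq_div_iff (pow_ne_zero _ m0) (pow_ne_zero _ n0)] at h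
  have h1 : n 1 * m 0 = n 0 * m 1 := by
    have h3 : (6 * m 0 ^ 2 * n 0 ^ 2) ≠ 0 := by
      simp [m0, n0]
    apply mul_left_cancel₀ h3
    linear_combination h
  refine ⟨n 0 / m 0, fun i => ?_⟩
  fin_cases i
  · simp [m0]
  · simp
    field_simp
    exact h1
  · simp
    field_simp
    have e1 := hm.sum_eq_zero
    have e2 := hn.sum_eq_zero
    linear_combination m 0 * e2 - n 0 * e1 - h1

theorem altProd_mul (x : ℂ) (m : Fin 3 → ℂ) : altProd (fun i => x * m i) = x ^ 3 * altProd m := by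
  simp only [altProd]; ring

/-! ### The depressed cubic and Cardano's formula -/

/-- The depressed cubic of three numbers with zero sum, `z³ + 3 r z + 2 s`. -/
structure IsDepressed (z : Fin 3 → ℂ) (r s : ℂ) : Prop where
  sum_eq_zero : z 0 + z 1 + z 2 = 0
  pair : z 0 * z 1 + z 1 * z 2 + z 2 * z 0 = 3 * r
  prod : z 0 * z 1 * z 2 = -2 * s

namespace IsDepressed

variable {z : Fin 3 → ℂ} {r s : ℂ} (h : IsDepressed z r s)
include h

theorem root (i : Fin 3) : z i ^ 3 + 3 * r * z i + 2 * s = 0 := by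
  have e1 := h.sum_eq_zero
  have e2 := h.pair
  have e3 := h.prod
  fin_cases i
  · simp; linear_combination z 0 ^ 2 * e1 - z 0 * e2 + e3
  · simp; linear_combination z 1 ^ 2 * e1 - z 1 * e2 + e3
  · simp; linear_combination z 2 ^ 2 * e1 - z 2 * e2 + e3

theorem discr : altProd z ^ 2 = -108 * (s ^ 2 + r ^ 3) := by
  have e1 : z 2 = -z 0 - z 1 := by linear_combination h.sum_eq_zero
  have e2 := h.pair
  have e3 := h.prod
  have er : r = -(z 0 ^ 2 + z 0 * z 1 + z 1 ^ 2) / 3 := by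
    rw [e1] at e2; linear_combination -e2 / 3
  have es : s = z 0 * z 1 * (z 0 + z 1) / 2 := by
    rw [e1] at e3; linear_combination e3 / 2
  rw [altProd, er, es, e1]
  ring

theorem injective (h0 : s ^ 2 + r ^ 3 ≠ 0) : Function.Injective z := by
  have hd : altProd z ≠ 0 := by
    intro h1
    have := h.discr
    rw [h1] at this
    apply h0
    linear_combination this / 108
  simp only [altProd, mul_ne_zero_iff, sub_ne_zero] at hd
  obtain ⟨⟨h01, h12⟩, h20⟩ := hd
  intro i j hij
  fin_cases i <;> fin_cases j <;> first | rfl | exfalso; simp at hij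
  · exact h01 hij
  · exact h20 hij.symm
  · exact h01 hij.symm
  · exact h12 hij
  · exact h20 hij
  · exact h12 hij.symm

end IsDepressed

/-- Cardano's formula. -/
theorem cardano {z r s w v : ℂ} (hz : z ^ 3 + 3 * r * z + 2 * s = 0) (hr : w * v = r)
    (hs : w ^ 3 - v ^ 3 = -2 * s) : ∃ x : ℂ, x ^ 3 = 1 ∧ z = x * w - x ^ 2 * v := by
  have hζ := Complex.isPrimitiveRoot_exp 3 (by norm_num)
  set ζ := Complex.exp (2 * Real.pi * I / (3 : ℕ))
  have h3 : ζ ^ 3 = 1 := hζ.pow_eq_one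
  have h1 : ζ - 1 ≠ 0 := sub_ne_zero.mpr (hζ.ne_one (by norm_num))
  have h2 : ζ ^ 2 + ζ + 1 = 0 := by
    apply mul_left_cancel₀ h1
    linear_combination h3
  have key : (z - (w - v)) * ((z - (ζ * w - ζ ^ 2 * v)) *
      (z - (ζ ^ 2 * w - (ζ ^ 2) ^ 2 * v))) = 0 := by
    have e : ζ ^ 2 = -ζ - 1 := by linear_combination h2
    have e4 : (ζ ^ 2) ^ 2 = ζ := by linear_combination ζ * h3
    rw [e4]
    have : (z - (w - v)) * ((z - (ζ * w - ζ ^ 2 * v)) * (z - (ζ ^ 2 * w - ζ * v))) =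
        z ^ 3 + 3 * (w * v) * z - (w ^ 3 - v ^ 3) := by
      rw [e]
      linear_combination -(z - (w - v)) * (w + v) ^ 2 * h2
    rw [this, hr, hs]
    linear_combination hz
  rcases mul_eq_zero.mp key with h | h
  · exact ⟨1, by norm_num, by linear_combination h⟩
  rcases mul_eq_zero.mp h with h | h
  · exact ⟨ζ, h3, by linear_combination h⟩
  · exact ⟨ζ ^ 2, by rw [← pow_mul, mul_comm, pow_mul, h3, one_pow], by linear_combination h⟩

/-- Inserting `z = x w - x² v`, with `w v = r` and `x³ = 1`, into the quadratic in `z` cancels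
everything except `x w (w³ + v³)`, and `w³ + v³ = 2 e Δ`. For the last claim, `z i - z j = (x i - x
j)(w + v x k)`, and the factors `w + v x k` multiply to `w³ + v³`. Since `altProd z` does not
involve `e`, a change of sign reverses the order of `x`. -/
theorem IsDepressed.exists_cubeTriple {z : Fin 3 → ℂ} {r s : ℂ} (h : IsDepressed z r s)
    {Δ e w : ℂ} (hΔ : Δ ≠ 0) (hΔ2 : Δ ^ 2 = s ^ 2 + r ^ 3) (he : e ^ 2 = 1)
    (hw : w ^ 3 = -s + e * Δ) (hw0 : w ≠ 0) :
    ∃ x : Fin 3 → ℂ, IsCubeTriple x ∧ (∀ i, x i ^ 3 = 1) ∧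
      (∀ i, w ^ 3 * z i + 2 * r ^ 2 + r * z i ^ 2 = 2 * w * Δ * (e * x i)) ∧
      altProd z = altProd x * (2 * e * Δ) := by
  set v := r / w with hv
  have hr : w * v = r := by rw [hv]; field_simp
  have hv3 : v ^ 3 = s + e * Δ := by
    have : w ^ 3 * v ^ 3 = w ^ 3 * (s + e * Δ) := by
      rw [← mul_pow, hr, hw]
      linear_combination -hΔ2 + Δ ^ 2 * (-he)
    exact mul_left_cancel₀ (pow_ne_zero _ hw0) this
  have hsum : w ^ 3 + v ^ 3 = 2 * e * Δ := by rw [hw, hv3]; ring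
  choose x hx1 hx2 using fun i => cardano (h.root i) hr (by rw [hw, hv3]; ring)
  have hinj : Function.Injective x := fun i j hij => h.injective (by rw [← hΔ2]; exact pow_ne_zero _ hΔ) (by
    rw [hx2 i, hx2 j, hij])
  have hx : IsCubeTriple x := ⟨fun i h0 => by
    have := hx1 i
    rw [h0] at this
    norm_num at this, fun i j => by rw [hx1, hx1], hinj⟩
  refine ⟨x, hx, hx1, fun i => ?_, ?_⟩
  · have e1 := hx1 i
    rw [hx2 i, ← hr]
    linear_combination w * x i * hsum + (-2 * w ^ 2 * v ^ 2 + w * v ^ 3 * x i) * e1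
  · have e0 := hx.sum_eq_zero
    have eq := hx.quad (show (0 : Fin 3) ≠ 1 by decide)
    have e2 : x 2 = -x 0 - x 1 := by linear_combination e0
    have e3 := hx1 2
    have f01 : z 0 - z 1 = (x 0 - x 1) * (w + v * x 2) := by
      rw [hx2, hx2, e2]; ring
    have f12 : z 1 - z 2 = (x 1 - x 2) * (w + v * x 0) := by
      rw [hx2, hx2, e2]; ring
    have f20 : z 2 - z 0 = (x 2 - x 0) * (w + v * x 1) := by
      rw [hx2, hx2, e2]; ring
    have p2 : x 0 * x 1 + x 1 * x 2 + x 2 * x 0 = 0 := by rw [e2]; linear_combination -eq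
    have p3 : x 0 * x 1 * x 2 = 1 := by linear_combination x 2 * p2 + e3 - x 2 ^ 2 * e0
    rw [← hsum, altProd, altProd, f01, f12, f20]
    linear_combination (x 0 - x 1) * (x 1 - x 2) * (x 2 - x 0) *
      (w ^ 2 * v * e0 + w * v ^ 2 * p2 + v ^ 3 * p3)

/-- Reality of the roots is essential: `w = 0` forces `r = 0`, then the sum of the squares of the
three real roots vanishes, so `s = 0` and `Δ = 0`. -/
theorem depressed_root_ne_zero {y : Fin 3 → ℝ} {r s : ℝ} {a : ℝ}
    (h : IsDepressed (fun i => ((y i - a : ℝ) : ℂ)) r s) {Δ e w : ℂ} (hΔ : Δ ≠ 0)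
    (hΔ2 : Δ ^ 2 = (s : ℂ) ^ 2 + (r : ℂ) ^ 3) (he : e ^ 2 = 1) (hw : w ^ 3 = -(s : ℂ) + e * Δ) :
    w ≠ 0 := by
  rintro rfl
  have h1 : Δ ^ 2 = (s : ℂ) ^ 2 := by
    have : e * Δ = s := by linear_combination -hw
    rw [← this, mul_pow, he, one_mul]
  have h2 : (r : ℂ) = 0 := by
    have : (r : ℂ) ^ 3 = 0 := by linear_combination h1 - hΔ2
    simpa using this
  have s1 := h.sum_eq_zero
  have s2 := h.pair
  have s3 := h.prod
  rw [h2] at s2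
  have s1' : (y 0 - a) + (y 1 - a) + (y 2 - a) = 0 := by exact_mod_cast s1
  have s2' : (y 0 - a) * (y 1 - a) + (y 1 - a) * (y 2 - a) + (y 2 - a) * (y 0 - a) = 0 := by
    have : (y 0 - a) * (y 1 - a) + (y 1 - a) * (y 2 - a) + (y 2 - a) * (y 0 - a) = 3 * 0 := by
      exact_mod_cast s2
    linarith
  have s4 : (y 0 - a) ^ 2 + (y 1 - a) ^ 2 + (y 2 - a) ^ 2 = 0 := by
    linear_combination ((y 0 - a) + (y 1 - a) + (y 2 - a)) * s1' - 2 * s2'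
  have s5 : y 0 - a = 0 := by
    have : (y 0 - a) ^ 2 = 0 := by nlinarith [sq_nonneg (y 0 - a), sq_nonneg (y 1 - a), sq_nonneg (y 2 - a)]
    simpa using this
  simp only [s5] at s3
  apply hΔ
  have : (s : ℂ) = 0 := by
    have : -2 * (s : ℂ) = 0 := by rw [← s3]; push_cast; ring
    simpa using this
  rw [this] at h1
  simpa using h1

/-! ### Reconstruction of a Weyl tensor from `H` -/

/-- The cyclic sum is totally antisymmetric, hence a multiple of the permutation symbol. The
multiple is the same for all frame vectors, so the cyclic identity follows from a zero sum of
eigenvalues. -/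
theorem sd_cyclic (f : Fin 3 → ℂ) (a b c d : Fin 4) :
    sd f a b * sd f c d + sd f a c * sd f d b + sd f a d * sd f b c
      = -I * (f ⬝ᵥ f) * leviCivita a b c d := by
  revert a b
  apply forall_pair_of_antisymm
  · intro a
    rw [sd_antisymm f d a]
    simp [leviCivita, show sd f a a = 0 by fin_cases a <;> simp [sd]]
    ring
  · intro a b h
    have e : leviCivita b a c d = -leviCivita a b c d := by
      clear h; revert a b c d; decide +kernel
    rw [e]
    push_cast
    rw [sd_antisymm f a b, sd_antisymm f a d, sd_antisymm f d b]
    linear_combination -h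
  intro a b hab
  revert c d
  apply forall_pair_of_antisymm
  · intro c
    rw [sd_antisymm f c b]
    simp [leviCivita, show sd f c c = 0 by fin_cases c <;> simp [sd]]
  · intro c d h
    have e : leviCivita a b d c = -leviCivita a b c d := by
      clear h hab; revert a b c d; decide +kernel
    rw [e]
    push_cast
    rw [sd_antisymm f c d, sd_antisymm f b c, sd_antisymm f d b]
    linear_combination -h
  intro c d hcd
  simp only [dotProduct, Fin.sum_univ_three]
  fin_cases a <;> fin_cases b <;> first | exact absurd hab (by decide) | skip
  all_goals
    fin_cases c <;> fin_cases d <;> first | exact absurd hcd (by decide) | skip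
  all_goals
    simp [sd, leviCivita]
    try ring_nf
    try simp
    try ring

theorem sd_mul_self (f : Fin 3 → ℂ) (b d : Fin 4) :
    ∑ a, sg ℂ a * (sd f a b * sd f a d) = -(f ⬝ᵥ f) * metric ℂ b d := by
  simp only [Fin.sum_univ_four, dotProduct, Fin.sum_univ_three, metric]
  fin_cases b <;> fin_cases d <;> simp [sd, sg] <;> ring_nf <;> simp <;> ring

theorem hodge_dyad {ι : Type} [Fintype ι] (F G : ι → Fin 3 → ℂ) (a b c d : Fin 4) :
    hodge (dyad F G) a b c d = I * dyad F G a b c d := by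
  have h : ∀ i, hodge2 (sd (F i)) a b = I * sd (F i) a b := fun i => hodge2_sd _ a b
  simp only [dyad, hodge_eq_hodge2, Finset.mul_sum]
  simp only [hodge2] at h ⊢
  simp only [← mul_assoc, ← h]
  simp only [Finset.mul_sum, Finset.sum_mul]
  calc _ = ∑ m, ∑ i, ∑ n, 1 / 2 * (vol ℂ a b m n * sg ℂ m * sg ℂ n * sd (F i) m n * sd (G i) c d) :=
        Finset.sum_congr rfl fun _ _ => by
          rw [Finset.sum_comm]
          simp only [mul_assoc]
    _ = _ := by
      rw [Finset.sum_comm]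
      simp only [mul_assoc]

/-- The dual is a real operator, so the conjugate of a self-dual dyad is anti-self-dual and is
annihilated by the projector. -/
theorem selfDualPart_of_real_dyad {ι : Type} [Fintype ι] {F G : ι → Fin 3 → ℂ} {W : Tens4 ℝ}
    (hW : ∀ a b c d, (W a b c d : ℂ) = dyad F G a b c d + conj (dyad F G a b c d)) :
    selfDualPart (toComplex W) = dyad F G := by
  funext a b c d
  have h1 : hodge (toComplex W) a b c d = I * dyad F G a b c d
      + conj (I * dyad F G a b c d) := by
    rw [← hodge_dyad]
    have h2 : conj (hodge (dyad F G) a b c d) =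
        hodge (fun a b c d => conj (dyad F G a b c d)) a b c d := by
      simp [hodge, vol_eq_leviCivita, conj_sg, map_ofNat]
    rw [h2]
    have h3 := hodge2_linear 1 1 (fun m n => dyad F G m n c d)
      (fun m n => conj (dyad F G m n c d)) a b
    simp only [one_mul] at h3
    rw [hodge_eq_hodge2, hodge_eq_hodge2, hodge_eq_hodge2, ← h3]
    simp only [toComplex, hW]
  rw [selfDualPart, h1, toComplex, hW, map_mul, Complex.conj_I]
  linear_combination (-1 / 2 * dyad F G a b c d + 1 / 2 * conj (dyad F G a b c d)) * Complex.I_sq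

/-- A real tensor with diagonal trace-free self-dual part is a Weyl tensor. -/
theorem isWeyl_of_frame {W : Tens4 ℝ} {u : Fin 3 → Fin 3 → ℂ} {n : Fin 3 → ℂ}
    (h : ∀ i j, u i ⬝ᵥ u j = if i = j then 1 / 2 else 0) (hn : ∑ i, n i = 0)
    (hW : ∀ a b c d, (W a b c d : ℂ) = dyad (fun i k => n i * u i k) u a b c d
      + conj (dyad (fun i k => n i * u i k) u a b c d)) :
    IsWeyl W ∧ IsFrame W u n := by
  refine ⟨?_, h, hn, selfDualPart_of_real_dyad hW⟩
  set D := dyad (fun i k => n i * u i k) u with hDdef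
  have hD : ∀ a b c d, D a b c d = ∑ i, n i * (sd (u i) a b * sd (u i) c d) := by
    intro a b c d
    refine Finset.sum_congr rfl fun i _ => ?_
    have : sd (fun k => n i * u i k) a b = n i * sd (u i) a b :=
      congrFun (congrFun (sdLin.map_smul (n i) (u i)) a) b
    simp only [this, mul_assoc]
  constructor
  · intro a b c d
    have : D b a c d = -D a b c d := by
      simp only [hD, sd_antisymm _ a b, ← Finset.sum_neg_distrib]
      exact Finset.sum_congr rfl fun i _ => by ring
    have e : (W b a c d : ℂ) = (-W a b c d : ℝ) := by
      push_cast
      rw [hW, hW, this, map_neg]; ring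
    exact_mod_cast e
  · intro a b c d
    have : D c d a b = D a b c d := by
      simp only [hD, mul_comm]
    have e : (W c d a b : ℂ) = W a b c d := by
      rw [hW, hW, this]
    exact_mod_cast e
  · intro a b c d
    have : D a b c d + D a c d b + D a d b c = 0 := by
      simp only [hD, ← Finset.sum_add_distrib, ← mul_add, sd_cyclic, h, if_true]
      rw [← Finset.sum_mul, hn, zero_mul]
    have e : ((W a b c d + W a c d b + W a d b c : ℝ) : ℂ) = (0 : ℝ) := by
      push_cast
      rw [hW, hW, hW]
      have h2 := congrArg conj this
      simp only [map_add, map_zero] at h2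
      linear_combination this + h2
    exact_mod_cast e
  · intro b d
    have : ∑ a, sg ℂ a * D a b a d = 0 := by
      simp only [hD, Finset.mul_sum]
      rw [Finset.sum_comm]
      have : ∀ i, ∑ a, sg ℂ a * (n i * (sd (u i) a b * sd (u i) a d)) =
          n i * (-(1 / 2) * metric ℂ b d) := fun i => by
        have h2 := sd_mul_self (u i) b d
        rw [h, if_pos rfl] at h2
        rw [← h2, Finset.mul_sum]
        exact Finset.sum_congr rfl fun a _ => by ring
      simp only [this]
      rw [← Finset.sum_mul, hn, zero_mul]
    have e : ((∑ a, sg ℝ a * W a b a d : ℝ) : ℂ) = (0 : ℝ) := by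
      push_cast
      simp only [hW, ofReal_sg, mul_add, Finset.sum_add_distrib]
      have h2 := congrArg conj this
      simp only [map_sum, map_mul, map_zero, conj_sg] at h2
      rw [this, h2, zero_add]
    exact_mod_cast e

/-- The tensor `J` of `H = ∑ x i • p i ⊗ p i`, with `p` the eigentensors of a frame. -/
theorem tensJ_eq {u : Fin 3 → Fin 3 → ℂ} {x : Fin 3 → ℂ}
    (h : ∀ i j, u i ⬝ᵥ u j = if i = j then 1 / 2 else 0) (hx : ∑ i, x i = 0) {H : Tens4 ℂ}
    (hH : ∀ a b c d, H a b c d = ∑ i, x i * (frameMixed u (i, i) a b * frameMixed u (i, i) c d))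
    (a b c d : Fin 4) : tensJ H a b c d = -dyad (fun i k => x i * u i k) u a b c d
      - ∑ i, x i * (asd (fun k => conj (u i k)) a b * asd (fun k => conj (u i k)) c d) := by
  have hc : ∀ i, (fun k => conj (u i k)) ⬝ᵥ (fun k => conj (u i k)) = 1 / 2 := fun i => by
    have := congrArg conj (h i i)
    simp only [dotProduct, map_sum, map_mul, if_true] at this ⊢
    rw [this]
    simp [map_ofNat]
  have hD : dyad (fun i k => x i * u i k) u a b c d = ∑ i, x i * (sd (u i) a b * sd (u i) c d) := by
    refine Finset.sum_congr rfl fun i _ => ?_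
    have : sd (fun k => x i * u i k) a b = x i * sd (u i) a b :=
      congrFun (congrFun (sdLin.map_smul (x i) (u i)) a) b
    simp only [this, mul_assoc]
  -- The metric term of `mixed_wedge` has the same coefficient for every `i`, so the zero sum of the
  -- weights removes it.
  have hG : ∑ i, x i * (metric ℂ a c * metric ℂ b d - metric ℂ a d * metric ℂ b c) = 0 := by
    rw [← Finset.sum_mul, hx, zero_mul]
  have key : ∀ i, 2 * (x i * (frameMixed u (i, i) a c * frameMixed u (i, i) b d)
      - x i * (frameMixed u (i, i) a d * frameMixed u (i, i) b c)) =
      -(x i * (sd (u i) a b * sd (u i) c d))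
      - x i * (asd (fun k => conj (u i k)) a b * asd (fun k => conj (u i k)) c d)
      - 1 / 2 * (x i * (metric ℂ a c * metric ℂ b d - metric ℂ a d * metric ℂ b c)) := fun i => by
    have := mixed_wedge (u i) (fun k => conj (u i k)) a b c d
    rw [hc, h, if_pos rfl] at this
    simp only [frameMixed]
    linear_combination 2 * x i * this
  rw [tensJ, hH, hH, ← Finset.sum_sub_distrib, Finset.mul_sum]
  simp only [key, Finset.sum_sub_distrib, Finset.sum_neg_distrib, ← Finset.mul_sum]
  rw [hD]
  linear_combination (-1 / 2) * hG

theorem hodge_asd_dyad {ι : Type} [Fintype ι] (x : ι → ℂ) (F G : ι → Fin 3 → ℂ) (a b c d : Fin 4) :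
    hodge (fun a b c d => ∑ i, x i * (asd (F i) a b * asd (G i) c d)) a b c d =
      -I * ∑ i, x i * (asd (F i) a b * asd (G i) c d) := by
  have h : ∀ i, hodge2 (asd (F i)) a b = -I * asd (F i) a b := fun i => hodge2_asd _ a b
  have e : -I * ∑ i, x i * (asd (F i) a b * asd (G i) c d) =
      ∑ i, x i * ((-I * asd (F i) a b) * asd (G i) c d) := by
    rw [Finset.mul_sum]
    exact Finset.sum_congr rfl fun i _ => by ring
  rw [e]
  simp only [← h, hodge, hodge2, Finset.mul_sum, Finset.sum_mul]
  calc _ = ∑ m, ∑ i, ∑ n, 1 / 2 * (vol ℂ a b m n * sg ℂ m * sg ℂ n *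
          (x i * (asd (F i) m n * asd (G i) c d))) :=
        Finset.sum_congr rfl fun _ _ => Finset.sum_comm
    _ = ∑ i, ∑ m, ∑ n, 1 / 2 * (vol ℂ a b m n * sg ℂ m * sg ℂ n *
          (x i * (asd (F i) m n * asd (G i) c d))) := Finset.sum_comm
    _ = _ := Finset.sum_congr rfl fun _ _ => Finset.sum_congr rfl fun _ _ =>
        Finset.sum_congr rfl fun _ _ => by ring

/-- `J = -D - Y` with `D` self-dual and `Y` anti-self-dual, but `Y` carries the weights `x i` rather
than their conjugates, so it is not `D̄` in general. Taking `J - i *J = -2D` discards `Y`, and the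
real part supplies the correct conjugate. -/
theorem weylZero_isFrame {u : Fin 3 → Fin 3 → ℂ} {x : Fin 3 → ℂ} (t : ℝ)
    (h : ∀ i j, u i ⬝ᵥ u j = if i = j then 1 / 2 else 0) (hx : ∑ i, x i = 0) {H : Tens4 ℂ}
    (hH : ∀ a b c d, H a b c d = ∑ i, x i * (frameMixed u (i, i) a b * frameMixed u (i, i) c d)) :
    IsWeyl (weylZero t (tensJ H)) ∧
    IsFrame (weylZero t (tensJ H)) u (fun i => -(Real.sqrt t) * x i) ∧
    selfDualPart (toComplex (weylZero t (tensJ H))) =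
      selfDualPart fun a b c d => (Real.sqrt t : ℂ) * tensJ H a b c d := by
  set D := dyad (fun i k => x i * u i k) u with hD
  set Y : Tens4 ℂ := fun a b c d =>
    ∑ i, x i * (asd (fun k => conj (u i k)) a b * asd (fun k => conj (u i k)) c d) with hY
  have hJ : ∀ a b c d, tensJ H a b c d = -D a b c d - Y a b c d := tensJ_eq h hx hH
  have hD2 : ∀ a b c d, hodge D a b c d = I * D a b c d := hodge_dyad _ _
  have hY2 : ∀ a b c d, hodge Y a b c d = -I * Y a b c d := hodge_asd_dyad _ _ _
  have hJ2 : ∀ a b c d (y : ℂ), hodge (fun a b c d => y * tensJ H a b c d) a b c d =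
      y * (-I * D a b c d + I * Y a b c d) := by
    intro a b c d y
    have := hodge2_linear (-y) (-y) (fun m n => D m n c d) (fun m n => Y m n c d) a b
    rw [← hodge_eq_hodge2 D, ← hodge_eq_hodge2 Y, hD2, hY2] at this
    rw [hodge_eq_hodge2, show y * (-I * D a b c d + I * Y a b c d) =
      -y * (I * D a b c d) + -y * (-I * Y a b c d) by ring, ← this]
    congr 1
    funext m n
    rw [hJ]; ring
  have hJ1 : ∀ a b c d, hodge (tensJ H) a b c d = -I * D a b c d + I * Y a b c d := by
    intro a b c d
    have := hJ2 a b c d 1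
    simpa only [one_mul] using this
  have hn : ∑ i, -(Real.sqrt t : ℂ) * x i = 0 := by rw [← Finset.mul_sum, hx, mul_zero]
  have hD3 : ∀ a b c d, dyad (fun i k => -(Real.sqrt t : ℂ) * x i * u i k) u a b c d =
      -(Real.sqrt t : ℂ) * D a b c d := by
    intro a b c d
    rw [hD, dyad, dyad, Finset.mul_sum]
    refine Finset.sum_congr rfl fun i _ => ?_
    have h1 : sd (fun k => -(Real.sqrt t : ℂ) * x i * u i k) a b =
        -(Real.sqrt t : ℂ) * x i * sd (u i) a b :=
      congrFun (congrFun (sdLin.map_smul (-(Real.sqrt t : ℂ) * x i) (u i)) a) b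
    have h2 : sd (fun k => x i * u i k) a b = x i * sd (u i) a b :=
      congrFun (congrFun (sdLin.map_smul (x i) (u i)) a) b
    rw [h1, h2]
    ring
  obtain ⟨h1, h2⟩ := isWeyl_of_frame (W := weylZero t (tensJ H)) h hn (by
    intro a b c d
    have e : tensJ H a b c d - I * hodge (tensJ H) a b c d = -2 * D a b c d := by
      rw [hJ1, hJ]
      linear_combination (D a b c d - Y a b c d) * Complex.I_sq
    rw [hD3, weylZero, e, map_mul, map_neg, Complex.conj_ofReal]
    push_cast
    have := Complex.add_conj (D a b c d)
    rw [show ((-2 * D a b c d).re : ℂ) = -(2 * (D a b c d).re : ℝ) by simp, ← this]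
    ring)
  refine ⟨h1, h2, ?_⟩
  rw [h2.dec]
  funext a b c d
  rw [hD3, selfDualPart, hJ2, hJ]
  linear_combination (Real.sqrt t : ℂ) * (-1 / 2) * (D a b c d - Y a b c d) * Complex.I_sq

/-! ### Phases and duality rotations -/

theorem sd_smul (x : ℂ) (f : Fin 3 → ℂ) (a b : Fin 4) :
    sd (fun k => x * f k) a b = x * sd f a b :=
  congrFun (congrFun (sdLin.map_smul x f) a) b

theorem dyad_smul {ι : Type} [Fintype ι] (x : ℂ) (F G : ι → Fin 3 → ℂ) (a b c d : Fin 4) :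
    dyad (fun i k => x * F i k) G a b c d = x * dyad F G a b c d := by
  simp only [dyad, sd_smul, Finset.mul_sum, mul_assoc]

theorem dyad_frame_injective {u : Fin 3 → Fin 3 → ℂ}
    (h : ∀ i j, u i ⬝ᵥ u j = if i = j then 1 / 2 else 0) {m n : Fin 3 → ℂ}
    (hd : dyad (fun i k => m i * u i k) u = dyad (fun i k => n i * u i k) u) : m = n := by
  have e : ∀ (x : Fin 3 → ℂ) (j : Fin 3) (a b : Fin 4),
      sdApply (dyad (fun i k => x i * u i k) u) (sd (u j)) a b = -x j * sd (u j) a b := by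
    intro x j a b
    rw [sdApply_dyad, Finset.sum_eq_single j]
    · rw [h, if_pos rfl, sd_smul]; ring
    · intro i _ hi
      rw [h, if_neg hi]; ring
    · simp
  funext j
  have h1 : sd (fun k => -m j * u j k) = sd (fun k => -n j * u j k) := by
    funext a b
    rw [sd_smul, sd_smul, ← e, ← e, hd]
  have h2 := sd_injective h1
  have h3 : ∑ k, -m j * u j k * u j k = ∑ k, -n j * u j k * u j k :=
    Finset.sum_congr rfl fun k _ => by rw [congrFun h2 k]
  simp only [mul_assoc, ← Finset.mul_sum] at h3
  have h4 := h j j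
  simp only [dotProduct, if_true] at h4
  rw [h4] at h3
  linear_combination -2 * h3

theorem belRobinson_eq_of_phase {W W' : Tens4 ℝ} {ι : Type} [Fintype ι] {F G : ι → Fin 3 → ℂ}
    (hW : selfDualPart (toComplex W) = dyad F G) {x : ℂ} (hx : x * conj x = 1)
    (h : ∀ a b c d, selfDualPart (toComplex W') a b c d = x * selfDualPart (toComplex W) a b c d) :
    belRobinson W' = belRobinson W := by
  have hW' : selfDualPart (toComplex W') = dyad (fun i k => x * F i k) G := by
    funext a b c d
    rw [h, hW, dyad_smul]
  funext a b c d
  have e : (belRobinson W' a b c d : ℂ) = belRobinson W a b c d := by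
    rw [belRobinson_of_dyad hW', belRobinson_of_dyad hW]
    simp only [map_mul, mixed_smul, hx, one_mul]
  exact_mod_cast e

theorem conj_stdVec (j : Fin 3) : (fun k => conj (stdVec j k)) = stdVec j := by
  funext k
  simp only [stdVec, Pi.single_apply]
  split_ifs <;> simp

/-- Contraction with the products of standard bivectors recovers all numbers `q i k * conj (q j l)`
from `T`. Comparing them at one non-zero entry gives the factor, and the diagonal case shows that it
has modulus 1. -/
theorem IsWeyl.phase_of_belRobinson_eq {W W' : Tens4 ℝ} (hW : IsWeyl W) (hW' : IsWeyl W')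
    (h : belRobinson W' = belRobinson W) (h0 : selfDualPart (toComplex W) ≠ 0) :
    ∃ x : ℂ, x * conj x = 1 ∧
      ∀ a b c d, selfDualPart (toComplex W') a b c d = x * selfDualPart (toComplex W) a b c d := by
  obtain ⟨q, -, -, hq⟩ := hW.exists_matrix
  obtain ⟨q', -, -, hq'⟩ := hW'.exists_matrix
  have hm : ∀ (V : Tens4 ℝ) (p : Matrix (Fin 3) (Fin 3) ℂ),
      selfDualPart (toComplex V) = dyad stdVec p → ∀ i j c d,
      contrC (fun a b => (belRobinson V a b c d : ℂ)) (mixed (stdVec i) (stdVec j)) =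
        4 * mixed (p i) (fun k => conj (p j k)) c d := by
    intro V p hp i j c d
    have e : (fun a b => (belRobinson V a b c d : ℂ)) = fun a b => ∑ k : Fin 3 × Fin 3,
        mixed (p k.1) (fun i => conj (p k.2 i)) c d * mixed (stdVec k.1) (stdVec k.2) a b := by
      funext a b
      rw [belRobinson_of_dyad hp, Fintype.sum_prod_type]
      simp only [conj_stdVec, mul_comm]
    rw [e, contrC_sum, Finset.sum_eq_single (i, j)]
    · rw [contrC, contr_mixed]
      simp [stdVec, mul_comm]
    · rintro ⟨k, l⟩ _ hkl
      rw [contrC, contr_mixed]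
      by_cases h1 : k = i
      · have : l ≠ j := fun h2 => hkl (by rw [h1, h2])
        simp [stdVec, this.symm]
      · simp [stdVec, Ne.symm h1]
    · simp
  have key : ∀ i j k l, q' i k * conj (q' j l) = q i k * conj (q j l) := by
    intro i j k l
    have e : mixed (q' i) (fun k => conj (q' j k)) = mixed (q i) (fun k => conj (q j k)) := by
      funext c d
      have h1 := hm W' q' hq' i j c d
      rw [h, hm W q hq i j c d] at h1
      linear_combination (-1 / 4) * h1
    have e1 := contr_mixed (q' i) (fun k => conj (q' j k)) (stdVec k) (stdVec l)
    rw [e, contr_mixed] at e1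
    simp [stdVec] at e1
    linear_combination (-1 / 4) * e1
  obtain ⟨j, l, hjl⟩ : ∃ j l, q j l ≠ 0 := by
    by_contra! hn
    apply h0
    rw [hq]
    have : ∀ i, sd (q i) = 0 := fun i => by
      have e : q i = fun k => 0 * q i k := by
        funext k; rw [hn]; simp
      rw [e]
      funext a b
      rw [sd_smul]; simp
    funext a b c d
    simp [dyad, this]
  have hn := key j j l l
  rw [Complex.mul_conj, Complex.mul_conj] at hn
  have hjl' : q' j l ≠ 0 := by
    intro h1
    rw [h1] at hn
    simp only [map_zero, Complex.ofReal_zero] at hn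
    exact hjl (Complex.normSq_eq_zero.mp (by exact_mod_cast hn.symm))
  have hc : conj (q' j l) ≠ 0 := by simpa using hjl'
  refine ⟨conj (q j l) / conj (q' j l), ?_, ?_⟩
  · have h2 := key j j l l
    rw [map_div₀, Complex.conj_conj, Complex.conj_conj]
    field_simp
    linear_combination -h2
  · intro a b c d
    rw [hq, hq']
    change ∑ i, sd (stdVec i) a b * sd (q' i) c d = _ * ∑ i, sd (stdVec i) a b * sd (q i) c d
    rw [Finset.mul_sum]
    refine Finset.sum_congr rfl fun i _ => ?_
    have e : q' i = fun k => conj (q j l) / conj (q' j l) * q i k := by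
      funext k
      field_simp
      linear_combination key i j k l
    rw [e, sd_smul]
    ring

/-- The dual acts on self-dual parts as multiplication by `i`, and a real tensor is recovered from
its self-dual part. -/
theorem rotation_iff {W W₀ : Tens4 ℝ} {ι : Type} [Fintype ι] {F G : ι → Fin 3 → ℂ}
    (h₀ : selfDualPart (toComplex W₀) = dyad F G) (x y : ℝ) :
    (∀ a b c d, W a b c d = x * W₀ a b c d + y * hodge W₀ a b c d) ↔
      ∀ a b c d, selfDualPart (toComplex W) a b c d =
        (x + y * I) * selfDualPart (toComplex W₀) a b c d := by
  have e : ∀ a b c d, ((x * W₀ a b c d + y * hodge W₀ a b c d : ℝ) : ℂ) =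
      (x + y * I) * selfDualPart (toComplex W₀) a b c d
        + conj ((x + y * I) * selfDualPart (toComplex W₀) a b c d) := by
    intro a b c d
    push_cast
    rw [ofReal_hodge, dyad_real_part W₀]
    simp
    ring
  constructor
  · intro h a b c d
    rw [selfDualPart_of_real_dyad (W := W) (F := fun i k => (x + y * I) * F i k) (G := G), h₀,
      dyad_smul]
    intro a b c d
    rw [h, e, h₀, dyad_smul]
  · intro h a b c d
    have := dyad_real_part W a b c d
    rw [h, ← e] at this
    exact_mod_cast this

/-! ### The tensor `H` in a frame and the choice of `X` -/

/-- The shifted squares of the components of `X` in a frame. -/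
noncomputable def shifted (p : Fin 3 → Tens2 ℝ) (X : Tens2 ℝ) (i : Fin 3) : ℂ :=
  ((contr (p i) X ^ 2 - scalAlpha (projSum p) X : ℝ) : ℂ)

section

variable {p : Fin 3 → Tens2 ℝ}

theorem IsProjSystem.isDepressed (h : IsProjSystem p) (X : Tens2 ℝ) :
    IsDepressed (shifted p X) (scalR (projSum p) X) (scalS (projSum p) X) := by
  constructor <;>
  · simp only [shifted, scalR, scalS, h.scalBeta_eq, h.scalGamma_eq, scalAlpha_eq]
    push_cast
    ring

/-- On `p i ⊗ p i`, `E` has coefficient `z i + α`, and `I` the product of the other two squares,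
which is `z i² + 3r - α z i + α²` by the symmetric functions. The multiple of `A` in `H` is chosen
so that all explicit `α` cancel. -/
theorem IsProjSystem.tensH_eq (h : IsProjSystem p) (X : Tens2 ℝ) (Δ w : ℂ) (a b c d : Fin 4) :
    tensH (projSum p) X Δ w a b c d = 1 / (2 * w * Δ) * ∑ i,
      (w ^ 3 * shifted p X i + 2 * (scalR (projSum p) X : ℂ) ^ 2
        + scalR (projSum p) X * shifted p X i ^ 2) * (p i a b * p i c d) := by
  have hd := h.isDepressed X
  have e1 := hd.sum_eq_zero
  have e2 := hd.pair
  set r : ℂ := (scalR (projSum p) X : ℂ)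
  set α : ℂ := (scalAlpha (projSum p) X : ℂ) with hα
  have hy : ∀ i, (contr (p i) X : ℂ) ^ 2 = shifted p X i + α := fun i => by
    simp only [shifted]; push_cast; ring
  rw [tensH, h.tensE_eq, h.tensI_eq]
  congr 1
  simp only [projSum, Fin.sum_univ_three]
  push_cast
  simp only [hy]
  generalize (p 0 a b : ℂ) = a0
  generalize (p 1 a b : ℂ) = a1
  generalize (p 2 a b : ℂ) = a2
  generalize (p 0 c d : ℂ) = b0
  generalize (p 1 c d : ℂ) = b1
  generalize (p 2 c d : ℂ) = b2
  generalize shifted p X 0 = z0 at *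
  generalize shifted p X 1 = z1 at *
  generalize shifted p X 2 = z2 at *
  linear_combination r * (a0 * b0 * (e2 + (α - z0) * e1) + a1 * b1 * (e2 + (α - z1) * e1)
    + a2 * b2 * (e2 + (α - z2) * e1))

/-- `X = p 1 + 2 p 2` has components 0, 1, 2, whose squares are distinct, so the discriminant of the
cubic does not vanish. -/
theorem IsProjSystem.exists_admissible (h : IsProjSystem p) :
    ∃ X : Tens2 ℝ, (∀ a b, X a b = X b a) ∧
      scalS (projSum p) X ^ 2 + scalR (projSum p) X ^ 3 ≠ 0 := by
  set X : Tens2 ℝ := fun a b => p 1 a b + 2 * p 2 a b with hX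
  refine ⟨X, fun a b => by simp only [hX, h.symm _ a b], fun h0 => ?_⟩
  have hc : ∀ i, contr (p i) X = contr (p i) (p 1) + 2 * contr (p i) (p 2) := by
    intro i
    simp only [contr, hX, up, Finset.mul_sum, ← Finset.sum_add_distrib]
    exact Finset.sum_congr rfl fun _ _ => Finset.sum_congr rfl fun _ _ => by ring
  have h1 := (h.isDepressed X).discr
  have h2 : (scalS (projSum p) X : ℂ) ^ 2 + (scalR (projSum p) X : ℂ) ^ 3 = 0 := by
    exact_mod_cast h0
  rw [h2] at h1
  simp only [altProd, shifted, hc, h.contr_eq] at h1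
  simp at h1
  norm_num [sub_eq_zero] at h1
  exact one_ne_zero (α := ℂ) (by linear_combination -h1)

end

/-- The tensor `H` in a frame. -/
theorem IsFrame.tensH_eq {W : Tens4 ℝ} {u : Fin 3 → Fin 3 → ℂ} {m : Fin 3 → ℂ}
    (h : IsFrame W u m) {t : ℝ} (ht : IsCubeType (belRobinson W) t) (X : Tens2 ℝ) {Δ e w : ℂ}
    (hΔ : Δ ≠ 0) (hΔ2 : Δ ^ 2 = (scalS (concA (belRobinson W) t) X : ℂ) ^ 2 +
      (scalR (concA (belRobinson W) t) X : ℂ) ^ 3) (he : e ^ 2 = 1)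
    (hw : w ^ 3 = -(scalS (concA (belRobinson W) t) X : ℂ) + e * Δ) :
    w ≠ 0 ∧ ∃ x : Fin 3 → ℂ, IsCubeTriple x ∧ (∀ i, x i ^ 3 = 1) ∧
      (∀ a b c d, tensH (concA (belRobinson W) t) X Δ w a b c d =
        ∑ i, e * x i * (frameMixed u (i, i) a b * frameMixed u (i, i) c d)) ∧
      altProd (shifted (frameProj u) X) = altProd x * (2 * e * Δ) := by
  have hA : concA (belRobinson W) t = projSum (frameProj u) := by
    funext a b c d
    exact h.concA_eq ht a b c d
  rw [hA] at hΔ2 hw ⊢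
  have hp := isProjSystem_frameProj h.orth
  have hd := hp.isDepressed X
  have hw0 : w ≠ 0 := depressed_root_ne_zero (y := fun i => contr (frameProj u i) X ^ 2)
    (a := scalAlpha (projSum (frameProj u)) X) hd hΔ hΔ2 he hw
  obtain ⟨x, hx, hx1, hx2, hx3⟩ := hd.exists_cubeTriple hΔ hΔ2 he hw hw0
  refine ⟨hw0, x, hx, hx1, fun a b c d => ?_, hx3⟩
  rw [hp.tensH_eq, Finset.mul_sum]
  refine Finset.sum_congr rfl fun i _ => ?_
  rw [hx2, ofReal_frameProj, ofReal_frameProj]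
  field_simp

theorem IsFrame.weylZero_of_tensH {W : Tens4 ℝ} {u : Fin 3 → Fin 3 → ℂ} {m : Fin 3 → ℂ}
    (h : IsFrame W u m) {x : Fin 3 → ℂ} (hx : IsCubeTriple x) {e : ℂ} {H : Tens4 ℂ} (t : ℝ)
    (hH : ∀ a b c d, H a b c d =
      ∑ i, e * x i * (frameMixed u (i, i) a b * frameMixed u (i, i) c d)) :
    IsWeyl (weylZero t (tensJ H)) ∧
    IsFrame (weylZero t (tensJ H)) u (fun i => -(Real.sqrt t) * (e * x i)) ∧
    selfDualPart (toComplex (weylZero t (tensJ H))) =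
      selfDualPart fun a b c d => (Real.sqrt t : ℂ) * tensJ H a b c d := by
  refine weylZero_isFrame t h.orth ?_ hH
  rw [← Finset.mul_sum, Fin.sum_univ_three, hx.sum_eq_zero, mul_zero]

/-- The Weyl tensors with the same Bel-Robinson tensor as `W` are the duality rotations of a Weyl
tensor with proportional eigenvalues. -/
theorem IsFrame.belRobinson_eq_iff {W W₀ V : Tens4 ℝ} {u : Fin 3 → Fin 3 → ℂ} {m n : Fin 3 → ℂ}
    (h : IsFrame W u m) (hW : IsWeyl W) (h₀ : IsFrame W₀ u n) (hm : m 0 ≠ 0) {y : ℂ}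
    (hy : y * conj y = 1) (hn : ∀ i, n i = y * m i) (hV : IsWeyl V) :
    belRobinson V = belRobinson W ↔ ∃ θ : ℝ, ∀ a b c d, V a b c d =
      Real.cos θ * W₀ a b c d + Real.sin θ * hodge W₀ a b c d := by
  have hy0 : y ≠ 0 := by
    rintro rfl
    simp at hy
  have e0 : ∀ a b c d, selfDualPart (toComplex W₀) a b c d =
      y * selfDualPart (toComplex W) a b c d := by
    intro a b c d
    rw [h.dec, h₀.dec, ← dyad_smul]
    simp only [hn, mul_assoc]
  have ne : selfDualPart (toComplex W) ≠ 0 := by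
    intro hz
    have h1 : dyad (fun i k => m i * u i k) u = dyad (fun i k => (0 : Fin 3 → ℂ) i * u i k) u := by
      rw [← h.dec, hz]
      funext a b c d
      have := dyad_smul 0 u u a b c d
      simp only [Pi.zero_apply]
      rw [this]
      simp
    exact hm (congrFun (dyad_frame_injective h.orth h1) 0)
  simp only [rotation_iff h₀.dec]
  constructor
  · intro hb
    obtain ⟨x, hx, hx2⟩ := hW.phase_of_belRobinson_eq hV hb ne
    have hxy : (x / y) * conj (x / y) = 1 := by
      rw [map_div₀, div_mul_div_comm, hx, hy, div_one]
    have hnorm : ‖x / y‖ = 1 := by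
      rw [Complex.mul_conj, Complex.normSq_eq_norm_sq] at hxy
      have h2 : ‖x / y‖ ^ 2 = 1 := by exact_mod_cast hxy
      exact (pow_eq_one_iff_of_nonneg (norm_nonneg _) two_ne_zero).mp h2
    refine ⟨Complex.arg (x / y), fun a b c d => ?_⟩
    have h3 := Complex.norm_mul_cos_add_sin_mul_I (x / y)
    rw [hnorm, Complex.ofReal_one] at h3
    rw [hx2, e0, Complex.ofReal_cos, Complex.ofReal_sin]
    have h4 : Complex.cos (x / y).arg + Complex.sin (x / y).arg * I = x / y := by
      linear_combination h3
    rw [h4]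
    field_simp
  · rintro ⟨θ, hθ⟩
    apply belRobinson_eq_of_phase h.dec (x := (Real.cos θ + Real.sin θ * I) * y)
    · have h5 : ((Real.cos θ : ℂ)) ^ 2 + (Real.sin θ : ℂ) ^ 2 = 1 := by
        exact_mod_cast Real.cos_sq_add_sin_sq θ
      rw [map_mul, map_add, map_mul, Complex.conj_ofReal, Complex.conj_ofReal, Complex.conj_I]
      linear_combination (Real.cos θ ^ 2 + Real.sin θ ^ 2 : ℂ) * hy + h5
        - (Real.sin θ : ℂ) ^ 2 * y * conj y * Complex.I_sq
    · intro a b c d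
      rw [hθ, e0]
      ring

end BelRobinson

/-! ### The theorem and the choice of sign -/

theorem mainTheorem4 (T : Tens4 ℝ) (hT : IsBelRobinson T)
    (t : ℝ)
    (hT2 : Tr (comp T T) = 0)
    (ht : 9 * t ^ 3 = Tr (comp (comp T T) T))
    (hT3 : Tr (comp (comp T T) T) ≠ 0) :
    0 < t ∧
    -- every Weyl tensor with Bel-Robinson tensor `T` has a frame of canonical bivectors
    (∀ W, IsWeyl W → belRobinson W = T →
      ∃ U, IsEigenframe W U) ∧
    -- there are admissible symmetric tensors `X`
    (∃ X : Tens2 ℝ, (∀ a b, X a b = X b a) ∧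
      scalS (concA T t) X ^ 2 +
        scalR (concA T t) X ^ 3 ≠ 0) ∧
    ∀ X : Tens2 ℝ, (∀ a b, X a b = X b a) →
    ∀ Δ : ℂ, Δ ≠ 0 →
      Δ ^ 2 = (scalS (concA T t) X : ℂ) ^ 2 +
        (scalR (concA T t) X : ℂ) ^ 3 →
      -- what holds for both signs `ε` and every cube root `w`
      (∀ (ε : ℤˣ) (w : ℂ),
        w ^ 3 = -(scalS (concA T t) X : ℂ) + ((ε : ℤ) : ℂ) * Δ →
        w ≠ 0 ∧
        (∀ W, IsWeyl W → belRobinson W = T →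
          ∀ U, IsEigenframe W U →
          ∃ lam : Fin 3 → ℂ, Function.Injective lam ∧ (∀ i, lam i ^ 3 = 1) ∧
            ∀ a b c d, tensH (concA T t) X Δ w a b c d =
              ((ε : ℤ) : ℂ) * ∑ i, lam i *
                (eigenTensor (U i) a b * eigenTensor (U i) c d)) ∧
        IsWeyl (weylZero t
          (tensJ (tensH (concA T t) X Δ w))) ∧
        selfDualPart (toComplex (weylZero t
          (tensJ (tensH (concA T t) X Δ w)))) =
        selfDualPart (fun a b c d => (Real.sqrt t : ℂ) *
          tensJ (tensH (concA T t) X Δ w) a b c d)) ∧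
      -- for exactly one sign `ε`, the Weyl tensors of `T` are the duality rotations of `W₀`
      (∃! ε : ℤˣ, ∀ w : ℂ,
        w ^ 3 = -(scalS (concA T t) X : ℂ) + ((ε : ℤ) : ℂ) * Δ →
        ∀ W, IsWeyl W → (belRobinson W = T ↔
          ∃ θ : ℝ, ∀ a b c d, W a b c d =
            Real.cos θ * weylZero t (tensJ
              (tensH (concA T t) X Δ w)) a b c d +
            Real.sin θ * hodge (weylZero t (tensJ
              (tensH (concA T t) X Δ w))) a b c d)) := by
  obtain ⟨W₁, hW₁, rfl⟩ := hT
  have hc : IsCubeType (belRobinson W₁) t := ⟨hT2, ht, hT3⟩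
  obtain ⟨u₁, m₁, h₁⟩ := hW₁.exists_isFrame hT2 hT3
  obtain ⟨hm₁, hmt₁, htpos⟩ := h₁.spectrum hc
  refine ⟨htpos, ?_, ?_, ?_⟩
  · intro W hW hWT
    rw [← hWT] at hT2 hT3
    obtain ⟨u, m, h⟩ := hW.exists_isFrame hT2 hT3
    exact ⟨_, h.isEigenframe⟩
  · have hA : concA (belRobinson W₁) t = projSum (frameProj u₁) := by
      funext a b c d
      exact h₁.concA_eq hc a b c d
    rw [hA]
    exact (isProjSystem_frameProj h₁.orth).exists_admissible
  intro X _ Δ hΔ hΔ2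
  have he : ∀ ε : ℤˣ, (((ε : ℤ) : ℂ)) ^ 2 = 1 := fun ε => by
    rcases Int.units_eq_one_or ε with rfl | rfl <;> simp
  refine ⟨?_, ?_⟩
  · intro ε w hw
    obtain ⟨hw0, x₁, hx₁, -, hH₁, -⟩ := h₁.tensH_eq hc X hΔ hΔ2 (he ε) hw
    obtain ⟨hWeyl, -, hsd⟩ := h₁.weylZero_of_tensH hx₁ t hH₁
    refine ⟨hw0, ?_, hWeyl, hsd⟩
    intro W hW hWT U hU
    obtain ⟨u, m, h, hUu⟩ := exists_isFrame_of_isEigenframe hW hU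
    -- `H` depends on `T` alone, so it may be computed in the given frame of `W` instead of that of
    -- `W₁`.
    rw [← hWT] at hc hΔ2 hw ⊢
    obtain ⟨-, x, hx, hx1, hH, -⟩ := h.tensH_eq hc X hΔ hΔ2 (he ε) hw
    refine ⟨x, hx.inj, hx1, fun a b c d => ?_⟩
    rw [hH, Finset.mul_sum]
    refine Finset.sum_congr rfl fun i _ => ?_
    rw [hUu, eigenTensor_sd, eigenTensor_sd, frameMixed, mul_assoc]
  · have hroot : ∀ ε : ℤˣ, ∃ w : ℂ, w ^ 3 = -(scalS (concA (belRobinson W₁) t) X : ℂ)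
        + ((ε : ℤ) : ℂ) * Δ := fun ε => IsAlgClosed.exists_pow_nat_eq _ (by norm_num)
    set K := altProd m₁ / m₁ 0 ^ 3 with hK
    have hm0 := hm₁.ne_zero 0
    have hK2 : K ^ 2 = -27 := by
      rw [hK, div_pow, hm₁.altProd_sq]
      field_simp
    have hK0 : K ≠ 0 := by
      intro h
      rw [h] at hK2
      norm_num at hK2
    set D := altProd (shifted (frameProj u₁) X)
    -- `K` and `D` depend on neither sign nor cube root. One application of Cardano with sign 1
    -- gives `D = 2 altProd x Δ` with `altProd x = ±K`, both squares being `-27`; this sign is the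
    -- one sought.
    obtain ⟨ε, hε⟩ : ∃ ε : ℤˣ, D = K * (2 * ((ε : ℤ) : ℂ) * Δ) := by
      obtain ⟨w, hw⟩ := hroot 1
      obtain ⟨-, x, hx, hx1, -, hD⟩ := h₁.tensH_eq hc X hΔ hΔ2 (he 1) hw
      have h2 := hx.altProd_sq
      rw [hx1, one_pow, mul_one, ← hK2] at h2
      rcases sq_eq_sq_iff_eq_or_eq_neg.mp h2 with h3 | h3
      · exact ⟨1, by rw [← h3]; exact hD⟩
      · refine ⟨-1, hD.trans ?_⟩
        rw [h3]
        simp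
    have halt : ∀ (ε' : ℤˣ) (x : Fin 3 → ℂ), D = altProd x * (2 * ((ε' : ℤ) : ℂ) * Δ) →
        altProd x * ((ε' : ℤ) : ℂ) = K * ((ε : ℤ) : ℂ) := by
      intro ε' x hD
      apply mul_right_cancel₀ (mul_ne_zero two_ne_zero hΔ)
      linear_combination hε - hD
    refine ⟨ε, ?_, ?_⟩
    · intro w hw W hW
      obtain ⟨hw0, x, hx, hx1, hH, hD⟩ := h₁.tensH_eq hc X hΔ hΔ2 (he ε) hw
      obtain ⟨-, hF, -⟩ := h₁.weylZero_of_tensH hx t hH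
      -- For the right sign the cube roots of unity run in the same cyclic order as the eigenvalues
      -- of `W₁`, hence are proportional to them.
      have hxK : altProd m₁ / m₁ 0 ^ 3 = altProd x / x 0 ^ 3 := by
        have h1 := halt ε x hD
        rw [hx1, div_one, ← hK]
        have h2 : ((ε : ℤ) : ℂ) ≠ 0 := fun h0 => by
          have := he ε
          rw [h0] at this
          norm_num at this
        exact (mul_right_cancel₀ h2 h1).symm
      obtain ⟨y, hy⟩ := hm₁.exists_eq_mul hx hxK
      refine h₁.belRobinson_eq_iff hW₁ hF hm0
        (y := -(Real.sqrt t) * (((ε : ℤ) : ℂ) * y)) ?_ (fun i => by rw [hy]; ring) hW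
      have hs : (Real.sqrt t : ℂ) * (Real.sqrt t : ℂ) = t := by
        exact_mod_cast Real.mul_self_sqrt htpos.le
      have hx0 : x 0 * (starRingEnd ℂ) (x 0) = 1 := by
        have h1 : ‖x 0‖ = 1 := by
          have := congrArg norm (hx1 0)
          rw [norm_pow, norm_one] at this
          exact (pow_eq_one_iff_of_nonneg (norm_nonneg _) three_ne_zero).mp this
        rw [Complex.mul_conj, Complex.normSq_eq_norm_sq, h1]
        norm_num
      have hyt : y * (starRingEnd ℂ) y * t = 1 := by
        rw [← hmt₁ 0, ← hx0, hy 0, map_mul]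
        ring
      rw [map_mul, map_mul, map_neg, Complex.conj_ofReal, map_intCast]
      linear_combination hyt + (((ε : ℤ) : ℂ)) ^ 2 * y * (starRingEnd ℂ) y * hs
        + y * (starRingEnd ℂ) y * t * he ε
    · intro ε' hclaim
      by_contra hne
      obtain ⟨w, hw⟩ := hroot ε'
      obtain ⟨hw0, x, hx, hx1, hH, hD⟩ := h₁.tensH_eq hc X hΔ hΔ2 (he ε') hw
      obtain ⟨-, hF, -⟩ := h₁.weylZero_of_tensH hx t hH
      obtain ⟨θ, hθ⟩ := (hclaim w hw W₁ hW₁).mp rfl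
      have h1 := (rotation_iff hF.dec _ _).mp hθ
      set z : ℂ := Real.cos θ + Real.sin θ * Complex.I
      have h2 : dyad (fun i k => m₁ i * u₁ i k) u₁ = dyad (fun i k =>
          (z * (-(Real.sqrt t) * (((ε' : ℤ) : ℂ) * x i))) * u₁ i k) u₁ := by
        funext a b c d
        rw [← h₁.dec, h1, hF.dec, ← dyad_smul]
        simp only [mul_assoc]
      have h3 := dyad_frame_injective h₁.orth h2
      have h4 : m₁ = fun i => (z * (-(Real.sqrt t) * ((ε' : ℤ) : ℂ))) * x i := by
        rw [h3]
        funext i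
        ring
      -- If the other sign also worked, `W₁` would be a rotation of `W₀`; its eigenvalues would be a
      -- multiple of `x`, giving `x` the order `K` and so forcing the signs to agree.
      have h5 : K = altProd x := by
        have hq : z * (-(Real.sqrt t) * ((ε' : ℤ) : ℂ)) ≠ 0 := by
          intro h0
          rw [h0] at h4
          exact hm0 (by rw [h4]; ring)
        rw [hK, h4, altProd_mul]
        beta_reduce
        rw [mul_pow _ (x 0), hx1, mul_one, mul_div_cancel_left₀ _ (pow_ne_zero 3 hq)]
      have h6 := halt ε' x hD
      rw [← h5] at h6
      have h7 := mul_left_cancel₀ hK0 h6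
      apply hne
      ext
      exact_mod_cast h7
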